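/- Let $n\ge 1$. Consider the vertex superalgebra of local operators generated by symplectic bosons $(X_i,Y_i)$ and fermi multiplets $(\psi_i,\chi_i)$, $1\le i\le n$, and $bc$-ghosts $(b_a,c^a)$, $1\le a\le n-1$, acting on their common Fock space, where $X,Y$ are even, $\psi,\chi,b,c$ are odd, and the only singular operator products between generators are $$X_i(z)Y_j(0)\sim\frac{\delta_{ij}}{z},\qquad \psi_i(z)\chi_j(0)\sim\frac{\delta_{ij}}{z},\qquad b_a(z)c^b(0)\sim\frac{\delta_a^b}{z}$$ (and those obtained from these by exchanging the two factors). For operators $A,B$ and $p\in\mathbb Z$ put $(AB)_p(w)=\oint\frac{dz}{2\pi i}(z-w)^{p-1}A(z)B(w)$ (radially ordered); $AB$ stands for the normally ordered product $(AB)_0$, $ABC$ for $(A(BC)_0)_0$, and $[A,B]=(AB)_0-(BA)_0$. Let $$J_{BRST}=\sum_{a=1}^{n-1}c^a\left(X_aY_a-X_{a+1}Y_{a+1}+\psi_a\chi_a-\psi_{a+1}\chi_{a+1}\right),\qquad Q=\oint\frac{dz}{2\pi i}J_{BRST}(z),$$ let $Q$ act on operators by $Q\mathcal O=(J_{BRST}\,\mathcal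 O)_1$, and write $A\equiv B$ if $A-B=Q\mathcal O$ for some operator $\mathcal O$ of the algebra. Put $\mathcal A_i=-X_iY_i$, $\hat{\mathcal A}_i\mathcal O=(\mathcal A_i\mathcal O)_0$, $\mathcal D_i\mathcal O=(\mathcal A_i\mathcal O)_0+(X_i(Y_i\mathcal O)_0)_0$, $D_i=\mathcal D_i+\hat{\mathcal A}_i$, $T_i=\tfrac12 D_i\mathcal A_i$, and $$U=-\frac1n\sum_{i=1}^nX_iY_i,\qquad U_F=-\frac1n\sum_{i=1}^n\psi_i\chi_i,\qquad M_i^+=X_i\psi_i,\qquad M_i^-=Y_i\chi_i .$$ Then for every $i\in\{1,\dots,n\}$ $$T_i\equiv\tfrac12\,(U+U_F)^2-\tfrac12\,[M_i^+,M_i^-].$$ -/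

import Mathlib

open scoped TensorProduct VertexOperator

noncomputable section

namespace FreeFieldVOA

/-! ### Fields and their products

A field `A(z) = ∑ₘ A₍ₘ₎ z^(-m-1)` on a complex vector space `V` is a `VertexOperator ℂ V`;
the mode `A₍ₘ₎` is `A[[m]]`. -/

section Fields

variable {V : Type*} [AddCommGroup V] [Module ℂ V]

theorem exists_modes_eq_zero (A : VertexOperator ℂ V) (v : V) :
    ∃ N : ℤ, ∀ m, N ≤ m → (A[[m]]) v = 0 := by
  refine ⟨-((HahnModule.of ℂ).symm (A v)).order, fun m hm => ?_⟩
  apply VertexOperator.ncoeff_eq_zero_of_lt_order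
  omega

/-- The field with prescribed modes. -/
def ofModes (f : ℤ → Module.End ℂ V) (hf : ∀ v, ∃ N : ℤ, ∀ m, N ≤ m → f m v = 0) :
    VertexOperator ℂ V :=
  VertexOperator.of_coeff (fun k => f (-k - 1)) fun v => by
    obtain ⟨N, hN⟩ := hf v
    refine ⟨-N, fun k hk => ?_⟩
    by_contra h
    exact hk (hN _ (by omega))

@[simp]
theorem ncoeff_ofModes (f : ℤ → Module.End ℂ V)
    (hf : ∀ v, ∃ N : ℤ, ∀ m, N ≤ m → f m v = 0) (m : ℤ) : (ofModes f hf)[[m]] = f m := by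
  rw [ofModes, VertexOperator.ncoeff_of_coeff]
  congr 1
  ring

/-- The identity field. -/
def idField (V : Type*) [AddCommGroup V] [Module ℂ V] : VertexOperator ℂ V :=
  ofModes (fun m => if m = -1 then 1 else 0) fun v => ⟨0, fun m hm => by
    have h : m ≠ -1 := by omega
    simp [h]⟩

/-- The even part of an endomorphism of a superspace with parity involution `Γ`. -/
def evenPart (Γ a : Module.End ℂ V) : Module.End ℂ V := (1 / 2 : ℂ) • (a + Γ * a * Γ)

/-- The odd part of an endomorphism of a superspace with parity involution `Γ`. -/
def oddPart (Γ a : Module.End ℂ V) : Module.End ℂ V := (1 / 2 : ℂ) • (a - Γ * a * Γ)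

/-- The bilinear extension of `(-1)^(|a||b|) b a`. -/
def swapMul (Γ a b : Module.End ℂ V) : Module.End ℂ V :=
  b * evenPart Γ a + Γ * b * Γ * oddPart Γ a

/-- The `j`-th term of the `m`-th mode of `∮ dz/(2πi) (z - w)^r A(z) B(w)`. -/
def prodTerm (Γ : Module.End ℂ V) (r : ℤ) (A B : VertexOperator ℂ V) (m : ℤ) (j : ℕ) :
    Module.End ℂ V :=
  ((-1 : ℂ) ^ j * ((Ring.choose r j : ℤ) : ℂ)) •
    (A[[r - j]] * B[[m + j]] - (-1 : ℂ) ^ r • swapMul Γ (A[[(j : ℤ)]]) (B[[r + m - j]]))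

theorem swapMul_eq_zero (Γ a b : Module.End ℂ V) (v : V) (h : a v = 0) (h' : a (Γ v) = 0) :
    swapMul Γ a b v = 0 := by
  simp [swapMul, evenPart, oddPart, h, h']

theorem exists_prodTerm_eq_zero (Γ : Module.End ℂ V) (r : ℤ) (A B : VertexOperator ℂ V)
    (m : ℤ) (v : V) : ∃ J : ℕ, ∀ j, J ≤ j → prodTerm Γ r A B m j v = 0 := by
  obtain ⟨N₁, h₁⟩ := exists_modes_eq_zero A v
  obtain ⟨N₂, h₂⟩ := exists_modes_eq_zero A (Γ v)
  obtain ⟨N₃, h₃⟩ := exists_modes_eq_zero B v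
  refine ⟨N₁.toNat + N₂.toNat + (N₃ - m).toNat, fun j hj => ?_⟩
  have e₁ := h₁ j (by omega)
  have e₂ := h₂ j (by omega)
  have e₃ := h₃ (m + j) (by omega)
  simp [prodTerm, e₃, swapMul_eq_zero Γ _ _ v e₁ e₂]

theorem finite_support_prodTerm (Γ : Module.End ℂ V) (r : ℤ) (A B : VertexOperator ℂ V)
    (m : ℤ) (v : V) : (Function.support fun j => prodTerm Γ r A B m j v).Finite := by
  obtain ⟨J, hJ⟩ := exists_prodTerm_eq_zero Γ r A B m v
  refine (Set.finite_lt_nat J).subset fun j hj => ?_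
  by_contra h
  exact hj (hJ j (by simpa using h))

/-- The `m`-th mode of `∮ dz/(2πi) (z - w)^r A(z) B(w)`; on every vector the sum is finite. -/
def prodMode (Γ : Module.End ℂ V) (r : ℤ) (A B : VertexOperator ℂ V) (m : ℤ) :
    Module.End ℂ V where
  toFun v := ∑ᶠ j : ℕ, prodTerm Γ r A B m j v
  map_add' v w := by
    simp only [map_add]
    exact finsum_add_distrib (finite_support_prodTerm Γ r A B m v)
      (finite_support_prodTerm Γ r A B m w)
  map_smul' c v := by
    simp only [map_smul, RingHom.id_apply]
    exact (smul_finsum' c (finite_support_prodTerm Γ r A B m v)).symm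

theorem exists_prodMode_eq_zero (Γ : Module.End ℂ V) (r : ℤ) (A B : VertexOperator ℂ V)
    (v : V) : ∃ N : ℤ, ∀ m, N ≤ m → prodMode Γ r A B m v = 0 := by
  obtain ⟨N₁, h₁⟩ := exists_modes_eq_zero A v
  obtain ⟨N₂, h₂⟩ := exists_modes_eq_zero A (Γ v)
  obtain ⟨N₃, h₃⟩ := exists_modes_eq_zero B v
  choose K hK using fun u : V => exists_modes_eq_zero B u
  let J : ℕ := N₁.toNat + N₂.toNat
  let u₁ : ℕ → V := fun j => evenPart Γ (A[[(j : ℤ)]]) v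
  let u₂ : ℕ → V := fun j => Γ (oddPart Γ (A[[(j : ℤ)]]) v)
  let S : ℕ := ∑ j ∈ Finset.range J, ((K (u₁ j)).toNat + (K (u₂ j)).toNat)
  refine ⟨(N₃.toNat + S + J + r.natAbs : ℕ), fun m hm => ?_⟩
  change ∑ᶠ j : ℕ, prodTerm Γ r A B m j v = 0
  refine finsum_eq_zero_of_forall_eq_zero fun j => ?_
  have e₃ : (B[[m + j]]) v = 0 := h₃ _ (by omega)
  have e : swapMul Γ (A[[(j : ℤ)]]) (B[[r + m - j]]) v = 0 := by
    by_cases hj : J ≤ j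
    · exact swapMul_eq_zero Γ _ _ v (h₁ _ (by omega)) (h₂ _ (by omega))
    · have hle : (K (u₁ j)).toNat + (K (u₂ j)).toNat ≤ S :=
        Finset.single_le_sum (f := fun j => (K (u₁ j)).toNat + (K (u₂ j)).toNat)
          (fun _ _ => Nat.zero_le _) (Finset.mem_range.2 (not_le.1 hj))
      have f₁ : (B[[r + m - j]]) (u₁ j) = 0 := hK _ _ (by omega)
      have f₂ : (B[[r + m - j]]) (u₂ j) = 0 := hK _ _ (by omega)
      simp only [u₁, u₂] at f₁ f₂
      simp [swapMul, f₁, f₂]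
  simp [prodTerm, e₃, e]

/-- The product `(A B)_p (w) = ∮ dz/(2πi) (z - w)^(p-1) A(z) B(w)` of two fields (radially
ordered), for `p : ℤ`. With `r = p - 1`, it is the residue at `z = 0` of the expansion of
`(z - w)^r A(z) B(w)` in `|z| > |w|` minus that of `(-1)^(|A||B|) (z - w)^r B(w) A(z)` in
`|w| > |z|`. -/
def opProd (Γ : Module.End ℂ V) (p : ℤ) (A B : VertexOperator ℂ V) : VertexOperator ℂ V :=
  ofModes (prodMode Γ (p - 1) A B) (exists_prodMode_eq_zero Γ (p - 1) A B)

/-- The space of operators generated by a set `G` of fields: the smallest linear space of fields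
that contains `G` and the identity field and is closed under all products `(A B)_p`. -/
def operatorSpace (Γ : Module.End ℂ V) (G : Set (VertexOperator ℂ V)) :
    Submodule ℂ (VertexOperator ℂ V) :=
  sInf {S | idField V ∈ S ∧ G ⊆ S ∧ ∀ (p : ℤ), ∀ A ∈ S, ∀ B ∈ S, opProd Γ p A B ∈ S}

end Fields

/-! ### The Fock space of symplectic bosons, fermi multiplets and `bc`-ghosts -/

/-- Labels of the symplectic bosons `Xᵢ, Yᵢ`. -/
inductive Boson (n : ℕ) : Type
  | X (i : Fin n)
  | Y (i : Fin n)

/-- Labels of the fermi multiplets `ψᵢ, χᵢ` and of the ghosts `bₐ, cᵃ`. -/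
inductive Fermion (n : ℕ) : Type
  | psi (i : Fin n)
  | chi (i : Fin n)
  | b (a : Fin (n - 1))
  | c (a : Fin (n - 1))

/-- The fermionic field whose singular operator product with the given one is `1 / z`. -/
def Fermion.dual {n : ℕ} : Fermion n → Fermion n
  | .psi i => .chi i
  | .chi i => .psi i
  | .b a => .c a
  | .c a => .b a

/-- Polynomials in the creation modes `φ₍₋ₘ₋₁₎`, `m : ℕ`, of the bosons `φ`. -/
abbrev BosonFock (n : ℕ) : Type := MvPolynomial (Boson n × ℕ) ℂ

/-- The exterior algebra on the creation modes `φ₍₋ₘ₋₁₎`, `m : ℕ`, of the fermions `φ`. -/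
abbrev FermionFock (n : ℕ) : Type := ExteriorAlgebra ℂ (Fermion n × ℕ →₀ ℂ)

/-- The Fock space. -/
abbrev Fock (n : ℕ) : Type := BosonFock n ⊗[ℂ] FermionFock n

/-- The parity involution of the Fock space (the bosonic factor is even). -/
def parity (n : ℕ) : Module.End ℂ (Fock n) :=
  LinearMap.lTensor (BosonFock n)
    (CliffordAlgebra.involute (Q := (0 : QuadraticForm ℂ (Fermion n × ℕ →₀ ℂ)))).toLinearMap

/-- The modes of the symplectic bosons, with `[X₍ₘ₎, Y₍ₖ₎] = 1` if `m + k = -1`. -/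
def bosonMode {n : ℕ} : Boson n → ℤ → Module.End ℂ (BosonFock n)
  | φ, Int.negSucc m => LinearMap.mulLeft ℂ (MvPolynomial.X (φ, m))
  | .X i, Int.ofNat m => (MvPolynomial.pderiv (Boson.Y i, m)).toLinearMap
  | .Y i, Int.ofNat m => -(MvPolynomial.pderiv (Boson.X i, m)).toLinearMap

/-- The modes of the fermions, with `{φ₍ₘ₎, (dual φ)₍ₖ₎} = 1` if `m + k = -1`. -/
def fermionMode {n : ℕ} (φ : Fermion n) : ℤ → Module.End ℂ (FermionFock n)
  | Int.negSucc m => LinearMap.mulLeft ℂ (ExteriorAlgebra.ι ℂ (Finsupp.single (φ, m) 1))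
  | Int.ofNat m => CliffordAlgebra.contractLeft
      (Q := (0 : QuadraticForm ℂ (Fermion n × ℕ →₀ ℂ))) (Finsupp.lapply (φ.dual, m))

theorem exists_pderiv_eq_zero {n : ℕ} (φ : Boson n) (p : BosonFock n) :
    ∃ N : ℕ, ∀ m, N ≤ m → MvPolynomial.pderiv (φ, m) p = 0 := by
  classical
  refine ⟨p.vars.sup (fun x => x.2) + 1, fun m hm => ?_⟩
  apply MvPolynomial.pderiv_eq_zero_of_notMem_vars
  intro h
  have := Finset.le_sup (f := fun x : Boson n × ℕ => x.2) h
  simp only at this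
  omega

theorem exists_bosonMode_eq_zero {n : ℕ} (φ : Boson n) (p : BosonFock n) :
    ∃ N : ℤ, ∀ m, N ≤ m → bosonMode φ m p = 0 := by
  cases φ with
  | X i =>
    obtain ⟨N, hN⟩ := exists_pderiv_eq_zero (Boson.Y i) p
    refine ⟨N, fun m hm => ?_⟩
    lift m to ℕ using by omega
    simpa [bosonMode] using hN m (by omega)
  | Y i =>
    obtain ⟨N, hN⟩ := exists_pderiv_eq_zero (Boson.X i) p
    refine ⟨N, fun m hm => ?_⟩
    lift m to ℕ using by omega
    simpa [bosonMode] using hN m (by omega)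

theorem exists_contract_eq_zero {n : ℕ} (φ : Fermion n) (x : FermionFock n) :
    ∃ N : ℕ, ∀ m, N ≤ m → CliffordAlgebra.contractLeft
      (Q := (0 : QuadraticForm ℂ (Fermion n × ℕ →₀ ℂ))) (Finsupp.lapply (φ, m)) x = 0 := by
  induction x using CliffordAlgebra.left_induction with
  | algebraMap r => exact ⟨0, fun m _ => by simp⟩
  | add x y hx hy =>
    obtain ⟨N, hN⟩ := hx
    obtain ⟨M, hM⟩ := hy
    exact ⟨N + M, fun m hm => by rw [map_add, hN m (by omega), hM m (by omega), add_zero]⟩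
  | ι_mul x u hx =>
    classical
    obtain ⟨N, hN⟩ := hx
    refine ⟨N + u.support.sup (fun y => y.2) + 1, fun m hm => ?_⟩
    have hu : u (φ, m) = 0 := by
      by_contra h
      have := Finset.le_sup (f := fun y : Fermion n × ℕ => y.2) (Finsupp.mem_support_iff.2 h)
      simp only at this
      omega
    rw [CliffordAlgebra.contractLeft_ι_mul, hN m (by omega)]
    simp [hu]

theorem exists_fermionMode_eq_zero {n : ℕ} (φ : Fermion n) (x : FermionFock n) :
    ∃ N : ℤ, ∀ m, N ≤ m → fermionMode φ m x = 0 := by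
  obtain ⟨N, hN⟩ := exists_contract_eq_zero φ.dual x
  refine ⟨N, fun m hm => ?_⟩
  lift m to ℕ using by omega
  exact hN m (by omega)

/-- The field `Xᵢ(z)` or `Yᵢ(z)` on the Fock space. -/
def bosonField {n : ℕ} (φ : Boson n) : VertexOperator ℂ (Fock n) :=
  ofModes (fun m => LinearMap.rTensor (FermionFock n) (bosonMode φ m)) fun v => by
    induction v using TensorProduct.induction_on with
    | zero => exact ⟨0, fun m _ => map_zero _⟩
    | tmul p x =>
      obtain ⟨N, hN⟩ := exists_bosonMode_eq_zero φ p
      exact ⟨N, fun m hm => by rw [LinearMap.rTensor_tmul, hN m hm, TensorProduct.zero_tmul]⟩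
    | add v w hv hw =>
      obtain ⟨N, hN⟩ := hv
      obtain ⟨M, hM⟩ := hw
      exact ⟨max N M, fun m hm => by
        rw [map_add, hN m (by omega), hM m (by omega), add_zero]⟩

/-- The field `ψᵢ(z)`, `χᵢ(z)`, `bₐ(z)` or `cᵃ(z)` on the Fock space. -/
def fermionField {n : ℕ} (φ : Fermion n) : VertexOperator ℂ (Fock n) :=
  ofModes (fun m => LinearMap.lTensor (BosonFock n) (fermionMode φ m)) fun v => by
    induction v using TensorProduct.induction_on with
    | zero => exact ⟨0, fun m _ => map_zero _⟩
    | tmul p x =>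
      obtain ⟨N, hN⟩ := exists_fermionMode_eq_zero φ x
      exact ⟨N, fun m hm => by rw [LinearMap.lTensor_tmul, hN m hm, TensorProduct.tmul_zero]⟩
    | add v w hv hw =>
      obtain ⟨N, hN⟩ := hv
      obtain ⟨M, hM⟩ := hw
      exact ⟨max N M, fun m hm => by
        rw [map_add, hN m (by omega), hM m (by omega), add_zero]⟩

/-! ### The BRST charge and the operators of the theory -/

/-- The symplectic boson `Xᵢ`. -/
def X {n : ℕ} (i : Fin n) : VertexOperator ℂ (Fock n) := bosonField (.X i)

/-- The symplectic boson `Yᵢ`. -/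
def Y {n : ℕ} (i : Fin n) : VertexOperator ℂ (Fock n) := bosonField (.Y i)

/-- The fermi field `ψᵢ`. -/
def psi {n : ℕ} (i : Fin n) : VertexOperator ℂ (Fock n) := fermionField (.psi i)

/-- The fermi field `χᵢ`. -/
def chi {n : ℕ} (i : Fin n) : VertexOperator ℂ (Fock n) := fermionField (.chi i)

/-- The ghost `bₐ`. -/
def ghostB {n : ℕ} (a : Fin (n - 1)) : VertexOperator ℂ (Fock n) := fermionField (.b a)

/-- The ghost `cᵃ`. -/
def ghostC {n : ℕ} (a : Fin (n - 1)) : VertexOperator ℂ (Fock n) := fermionField (.c a)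

/-- The normally ordered product `(A B)₀`. -/
def nop {n : ℕ} (A B : VertexOperator ℂ (Fock n)) : VertexOperator ℂ (Fock n) :=
  opProd (parity n) 0 A B

/-- All operators: the fields generated by `Xᵢ, Yᵢ, ψᵢ, χᵢ, bₐ, cᵃ`. -/
def operators (n : ℕ) : Submodule ℂ (VertexOperator ℂ (Fock n)) :=
  operatorSpace (parity n) (Set.range bosonField ∪ Set.range fermionField)

/-- The current `Xᵢ Yᵢ + ψᵢ χᵢ`. -/
def current {n : ℕ} (i : Fin n) : VertexOperator ℂ (Fock n) :=
  nop (X i) (Y i) + nop (psi i) (chi i)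

/-- The BRST current `∑ₐ cᵃ (Xₐ Yₐ - Xₐ₊₁ Yₐ₊₁ + ψₐ χₐ - ψₐ₊₁ χₐ₊₁)`, `a = 1, …, n - 1`. -/
def brstCurrent (n : ℕ) : VertexOperator ℂ (Fock n) :=
  ∑ a : Fin (n - 1), nop (ghostC a)
    (current ⟨a, by omega⟩ - current ⟨a + 1, by omega⟩)

/-- The action `∮ dz/(2πi) J_BRST(z) A(w)` of the BRST charge on an operator `A`, that is the
supercommutator of the zero mode of the BRST current with `A`. -/
def brst {n : ℕ} (A : VertexOperator ℂ (Fock n)) : VertexOperator ℂ (Fock n) :=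
  opProd (parity n) 1 (brstCurrent n) A

/-- `A ≡ B`: the difference `A - B` is `Q`-exact. -/
def BRSTEquiv {n : ℕ} (A B : VertexOperator ℂ (Fock n)) : Prop :=
  ∃ C ∈ operators n, A - B = brst C

/-- `𝒜ᵢ = - Xᵢ Yᵢ`. -/
def gaugeA {n : ℕ} (i : Fin n) : VertexOperator ℂ (Fock n) := -nop (X i) (Y i)

/-- `Âᵢ O = (𝒜ᵢ O)₀`. -/
def hatA {n : ℕ} (i : Fin n) (O : VertexOperator ℂ (Fock n)) : VertexOperator ℂ (Fock n) :=
  nop (gaugeA i) O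

/-- `𝒟ᵢ O = (𝒜ᵢ O)₀ + (Xᵢ (Yᵢ O)₀)₀`. -/
def partialD {n : ℕ} (i : Fin n) (O : VertexOperator ℂ (Fock n)) : VertexOperator ℂ (Fock n) :=
  nop (gaugeA i) O + nop (X i) (nop (Y i) O)

/-- The covariant derivative `Dᵢ = 𝒟ᵢ + Âᵢ`. -/
def covD {n : ℕ} (i : Fin n) (O : VertexOperator ℂ (Fock n)) : VertexOperator ℂ (Fock n) :=
  partialD i O + hatA i O

/-- `Tᵢ = ½ Dᵢ 𝒜ᵢ`. -/
def T {n : ℕ} (i : Fin n) : VertexOperator ℂ (Fock n) := (1 / 2 : ℂ) • covD i (gaugeA i)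

/-- `U = - (1/n) ∑ᵢ Xᵢ Yᵢ`. -/
def U (n : ℕ) : VertexOperator ℂ (Fock n) := -(1 / n : ℂ) • ∑ i : Fin n, nop (X i) (Y i)

/-- `U_F = - (1/n) ∑ᵢ ψᵢ χᵢ`. -/
def UF (n : ℕ) : VertexOperator ℂ (Fock n) := -(1 / n : ℂ) • ∑ i : Fin n, nop (psi i) (chi i)

/-- `Mᵢ⁺ = Xᵢ ψᵢ`. -/
def Mplus {n : ℕ} (i : Fin n) : VertexOperator ℂ (Fock n) := nop (X i) (psi i)

/-- `Mᵢ⁻ = Yᵢ χᵢ`. -/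
def Mminus {n : ℕ} (i : Fin n) : VertexOperator ℂ (Fock n) := nop (Y i) (chi i)

end FreeFieldVOA

end

namespace FreeFieldVOA

section Fields

variable {V : Type*} [AddCommGroup V]

/-! ### Sums over the integers -/

/-! Write N_j = X_jY_j + ψ_jχ_j and let M be the mean of the N_j, so that U + U_F = -M. The proof
has an exact half and a cohomological half.

The exact half is an equality of fields: T_i + ½[M_i⁺, M_i⁻] = ½ N_iN_i. It comes from
`quartic_identity`, which rests on the failure of associativity of normal ordering. By
`opProd_opProd_eq`, if the modes of A and B contract with those of C through simple poles only,
(AB)C differs from A(BC) by single contractions placed in products ( )₋₁. Expanding every quartic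
composite this way, the bosonic corrections cancel and the fermionic ones add up to (ψχ)(ψχ).

The cohomological half shows that ½(N_iN_i - MM) is exact. The double pole of X_jY_j with itself is
opposite to that of ψ_jχ_j, so all modes of all currents commute (`current_mul_current`). Hence
N_iN_i - MM = (N_i - M)(N_i + M), and every combination P of currents is annihilated by Q. Since Q
b_a = N_a - N_{a+1} (`brst_ghostB`) and Q is a derivation (`opProd_one_opProd_zero`), Q(b_a P) =
(N_a - N_{a+1})P. Telescoping makes (N_i - N_j)P exact for all i and j, and N_i - M is the mean of
the N_i - N_j. -/

theorem finite_support_of_imp {ι W : Type*} [Zero W] {f : ι → V} {g : ι → W}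
    (hf : Function.HasFiniteSupport f) (h : ∀ i, f i = 0 → g i = 0) :
    Function.HasFiniteSupport g :=
  Set.Finite.subset hf fun i hi hfi => hi (h i hfi)

theorem finite_support_of_fibers (F : ℤ × ℤ → V) (a b : ℤ)
    (h₁ : ∀ p, p < a ∨ b ≤ p → ∀ q, F (p, q) = 0)
    (h₂ : ∀ p, Function.HasFiniteSupport fun q => F (p, q)) : Function.HasFiniteSupport F := by
  refine ((Set.finite_Ico a b).biUnion fun p _ => (h₂ p).image (Prod.mk p)).subset ?_
  rintro ⟨p, q⟩ hpq
  simp only [Set.mem_iUnion]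
  refine ⟨p, ?_, q, hpq, rfl⟩
  by_contra hp
  exact hpq (h₁ p (by simp only [Set.mem_Ico] at hp; omega) q)

/-- The gap of length k between the two halves is the shift in the expansion of (z - w)^(-1-k): its
creation terms start at mode -1-k and its annihilation terms at mode 0. -/
theorem finsum_int_eq (k : ℕ) (f : ℤ → V) (hf : Function.HasFiniteSupport f)
    (h0 : ∀ p : ℤ, -k ≤ p → p < 0 → f p = 0) :
    ∑ᶠ p, f p = ∑ᶠ j : ℕ, (f (-1 - k - j) + f j) := by
  have i₁ : Function.Injective fun j : ℕ => -1 - (k : ℤ) - j := fun a b h => by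
    simp only at h; omega
  have i₂ : Function.Injective fun j : ℕ => (j : ℤ) := fun a b h => by
    simp only at h; omega
  rw [finsum_add_distrib (Set.Finite.preimage i₁.injOn hf) (Set.Finite.preimage i₂.injOn hf),
    ← finsum_mem_range i₁, ← finsum_mem_range i₂,
    ← finsum_mem_union'' _ (Set.Finite.inter_of_right hf _) (Set.Finite.inter_of_right hf _)]
  · rw [← finsum_mem_univ]
    refine finsum_mem_inter_support_eq' _ _ _ fun p hp => ?_
    simp only [Set.mem_univ, true_iff]
    rcases lt_or_ge p 0 with h | h
    · have : p < -k := by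
        by_contra hk
        exact hp (h0 p (by omega) h)
      exact Or.inl ⟨(-1 - k - p).toNat, by simp only; omega⟩
    · exact Or.inr ⟨p.toNat, by simp only; omega⟩
  · rw [Set.disjoint_left]
    rintro p ⟨⟨a, ha⟩, -⟩ ⟨⟨b, hb⟩, -⟩
    simp only at ha hb
    omega

variable [Module ℂ V]

theorem field_ext {A B : VertexOperator ℂ V} (h : ∀ m v, (A[[m]]) v = (B[[m]]) v) : A = B := by
  ext v k
  have := h (-k - 1) v
  rwa [← VertexOperator.coeff_eq_ncoeff, ← VertexOperator.coeff_eq_ncoeff] at this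

/-- The signed indicator of the integers between `0` and `-1 - p`. -/
def step (p q : ℤ) : ℂ :=
  (if 0 ≤ q ∧ q < -1 - p then 1 else 0) - (if -1 - p ≤ q ∧ q < 0 then 1 else 0)

theorem finite_support_step (p : ℤ) (x : V) :
    Function.HasFiniteSupport fun q => step p q • x := by
  refine ((Set.finite_Ico 0 (-1 - p)).union (Set.finite_Ico (-1 - p) 0)).subset fun q hq => ?_
  by_contra h
  simp only [Set.mem_union, Set.mem_Ico, not_or] at h
  exact hq (by simp only [step, if_neg h.1, if_neg h.2, sub_zero, zero_smul])

/-- At most one of the two intervals is nonempty, and its signed length is -1 - p in either case.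
This is the weight of the p-th mode in a product ( )₋₁. -/
theorem finsum_step (p : ℤ) (x : V) : ∑ᶠ q, step p q • x = (-1 - p : ℂ) • x := by
  have h (a b : ℤ) : (fun q : ℤ => if a ≤ q ∧ q < b then x else 0).HasFiniteSupport := by
    refine (Set.finite_Ico a b).subset fun q hq => ?_
    by_contra h
    exact hq (if_neg h)
  have h' (a b : ℤ) : ∑ᶠ q : ℤ, (if a ≤ q ∧ q < b then x else 0) = (b - a).toNat • x := by
    rw [finsum_eq_finsetSum_of_support_subset (s := Finset.Ico a b)]
    · rw [← Int.card_Ico, ← Finset.sum_const]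
      refine Finset.sum_congr rfl fun q hq => if_pos (Finset.mem_Ico.1 hq)
    · intro q hq
      by_contra h
      simp only [Finset.coe_Ico, Set.mem_Ico] at h
      exact hq (if_neg h)
  have hstep (q : ℤ) : step p q • x =
      (if 0 ≤ q ∧ q < -1 - p then x else 0) - (if -1 - p ≤ q ∧ q < 0 then x else 0) := by
    simp only [step, sub_smul, ite_smul, one_smul, zero_smul]
  rw [finsum_congr hstep, finsum_sub_distrib (h _ _) (h _ _), h', h', ← Nat.cast_smul_eq_nsmul ℂ,
    ← Nat.cast_smul_eq_nsmul ℂ, ← sub_smul]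
  refine congrArg (fun c : ℂ => c • x) ?_
  have : (((-1 - p - 0).toNat : ℤ) - ((0 - (-1 - p)).toNat : ℤ)) = -1 - p := by omega
  exact_mod_cast this

/-! ### Normally ordered products of modes -/

/-- The normally ordered product `A₍ₚ₎ B₍q₎`, where `s` is the sign of the exchange. -/
def ord (s : ℂ) (A B : VertexOperator ℂ V) (p q : ℤ) : Module.End ℂ V :=
  if p < 0 then A[[p]] * B[[q]] else s • (B[[q]] * A[[p]])

theorem finite_support_ord (s : ℂ) (A B : VertexOperator ℂ V) (k : ℤ) (v : V) :
    Function.HasFiniteSupport fun p => ord s A B p (k - p) v := by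
  obtain ⟨N, hN⟩ := exists_modes_eq_zero A v
  obtain ⟨M, hM⟩ := exists_modes_eq_zero B v
  refine (Set.finite_Icc (-|k - M|) |N|).subset fun p hp => ?_
  by_contra h
  simp only [Set.mem_Icc, not_and_or, not_le] at h
  apply hp
  rcases lt_or_ge p 0 with h0 | h0
  · have : M ≤ k - p := by grind
    simp [ord, h0, hM _ this]
  · have : N ≤ p := by grind
    simp [ord, not_lt.2 h0, hN _ this]

theorem exists_ord_eq_zero (s : ℂ) (A B : VertexOperator ℂ V) (v : V) :
    ∃ N : ℤ, ∀ k, N ≤ k → ∀ p, ord s A B p (k - p) v = 0 := by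
  obtain ⟨N, hN⟩ := exists_modes_eq_zero A v
  obtain ⟨M, hM⟩ := exists_modes_eq_zero B v
  -- For p ≥ 0 the mode of B acts on A₍ₚ₎v, so its vanishing bound depends on p. Only 0 ≤ p < N
  -- matters, so a bound uniform in p exists.
  choose K hK using fun j : ℤ => exists_modes_eq_zero B ((A[[j]]) v)
  obtain ⟨L, hL⟩ := ((Finset.Ico 0 N).image fun j => K j + j).exists_le
  refine ⟨max M L, fun k hk p => ?_⟩
  rcases lt_or_ge p 0 with h0 | h0
  · have : M ≤ k - p := by grind
    simp [ord, h0, hM _ this]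
  · rcases lt_or_ge p N with h | h
    · have := hL (K p + p) (Finset.mem_image_of_mem _ (Finset.mem_Ico.2 ⟨h0, h⟩))
      simp [ord, not_lt.2 h0, hK p (k - p) (by grind)]
    · simp [ord, not_lt.2 h0, hN _ h]

/-- The field `A` has parity `e`. -/
def HasParity (Γ : Module.End ℂ V) (e : ℕ) (A : VertexOperator ℂ V) : Prop :=
  ∀ m, Γ * A[[m]] = (-1 : ℂ) ^ e • (A[[m]] * Γ)

theorem neg_one_pow_mul_self (e : ℕ) : (-1 : ℂ) ^ e * (-1) ^ e = 1 := by
  rw [← mul_pow]; simp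

section Parity

variable {Γ : Module.End ℂ V} {e f : ℕ} {A B : VertexOperator ℂ V}

/-- Parities are natural numbers, but only the sign (-1)^e carries information; this identifies, for
instance, degree 1 + 1 with degree 0. -/
theorem HasParity.congr (h : HasParity Γ e A) (hef : (-1 : ℂ) ^ e = (-1) ^ f) :
    HasParity Γ f A := fun m => hef ▸ h m

theorem HasParity.add (hA : HasParity Γ e A) (hB : HasParity Γ e B) : HasParity Γ e (A + B) :=
  fun m => by simp [mul_add, add_mul, hA m, hB m]

theorem HasParity.smul (hA : HasParity Γ e A) (c : ℂ) : HasParity Γ e (c • A) :=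
  fun m => by simp [hA m, smul_comm c]

theorem HasParity.zero : HasParity Γ e 0 := fun m => by simp

theorem HasParity.sum {ι : Type*} {A : ι → VertexOperator ℂ V} (s : Finset ι)
    (hA : ∀ i, HasParity Γ e (A i)) : HasParity Γ e (∑ i ∈ s, A i) :=
  Finset.sum_induction _ _ (fun _ _ => HasParity.add) HasParity.zero fun i _ => hA i

theorem HasParity.neg (hA : HasParity Γ e A) : HasParity Γ e (-A) :=
  fun m => by simp [hA m]

theorem HasParity.sub (hA : HasParity Γ e A) (hB : HasParity Γ e B) : HasParity Γ e (A - B) := by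
  rw [sub_eq_add_neg]; exact hA.add hB.neg

theorem swapMul_eq (hΓ : Γ * Γ = 1) {a b : Module.End ℂ V}
    (ha : Γ * a = (-1 : ℂ) ^ e • (a * Γ)) (hb : Γ * b = (-1 : ℂ) ^ f • (b * Γ)) :
    swapMul Γ a b = (-1 : ℂ) ^ (e * f) • (b * a) := by
  have ha' : Γ * a * Γ = (-1 : ℂ) ^ e • a := by rw [ha, smul_mul_assoc, mul_assoc, hΓ, mul_one]
  have hb' : Γ * b * Γ = (-1 : ℂ) ^ f • b := by rw [hb, smul_mul_assoc, mul_assoc, hΓ, mul_one]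
  rw [swapMul, evenPart, oddPart, ha', hb', pow_mul]
  rcases neg_one_pow_eq_or ℂ e with h | h <;> rw [h]
  · simp [← two_smul ℂ a, smul_smul]
  · simp [← two_smul ℂ a, smul_smul]

theorem ord_of_neg (s : ℂ) (A B : VertexOperator ℂ V) {p : ℤ} (hp : p < 0) (q : ℤ) :
    ord s A B p q = A[[p]] * B[[q]] := if_pos hp

theorem ord_of_nonneg (s : ℂ) (A B : VertexOperator ℂ V) {p : ℤ} (hp : 0 ≤ p) (q : ℤ) :
    ord s A B p q = s • (B[[q]] * A[[p]]) := if_neg (not_lt.2 hp)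

/-- The binomial coefficients of (z - w)^(-1) are signs that cancel against the alternating signs of
the expansion, leaving the unweighted sum with the modes p ≥ 0 of A on the right. -/
theorem ncoeff_opProd_zero (hΓ : Γ * Γ = 1) (hA : HasParity Γ e A) (hB : HasParity Γ f B)
    (m : ℤ) (v : V) : ((opProd Γ 0 A B)[[m]]) v =
      ∑ᶠ p, ord ((-1) ^ (e * f)) A B p (m - 1 - p) v := by
  rw [opProd, ncoeff_ofModes, finsum_int_eq 0 _ (finite_support_ord _ _ _ _ _)
    (fun p h h' => by omega)]
  refine finsum_congr fun j => ?_
  rw [ord_of_neg _ _ _ (by omega), ord_of_nonneg _ _ _ (by omega), prodTerm,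
    swapMul_eq hΓ (hA _) (hB _)]
  have : Ring.choose (0 - 1 : ℤ) j = (-1) ^ j := by
    rw [zero_sub, Ring.choose_neg', Ring.multichoose_one]
    simp [Int.negOnePow_def, Units.smul_def]
  rw [this]
  have h1 : m - 1 - (-1 - (0 : ℕ) - (j : ℤ)) = m + j := by simp; ring
  have h2 : 0 - 1 + m - (j : ℤ) = m - 1 - j := by ring
  rw [h1, h2]
  push_cast
  rw [neg_one_pow_mul_self]
  simp [sub_eq_add_neg]

/-- The coefficients of (z - w)^(-2) have absolute value j + 1, which is -1 - p on the creation half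
(p = -2 - j) and -(-1 - p) on the annihilation half (p = j). The mode p = -1, absent from both
halves, has weight zero. -/
theorem ncoeff_opProd_neg_one (hΓ : Γ * Γ = 1) (hA : HasParity Γ e A) (hB : HasParity Γ f B)
    (m : ℤ) (v : V) : ((opProd Γ (-1) A B)[[m]]) v =
      ∑ᶠ p : ℤ, (-1 - p : ℂ) • ord ((-1) ^ (e * f)) A B p (m - 2 - p) v := by
  rw [opProd, ncoeff_ofModes, finsum_int_eq 1 _ (finite_support_of_imp
    (finite_support_ord ((-1) ^ (e * f)) A B (m - 2) v) fun p hp => by simp [hp])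
    (fun p h h' => by obtain rfl : p = -1 := by omega
                      simp)]
  refine finsum_congr fun j => ?_
  rw [ord_of_neg _ _ _ (by omega), ord_of_nonneg _ _ _ (by omega), prodTerm,
    swapMul_eq hΓ (hA _) (hB _)]
  have : Ring.choose (-1 - 1 : ℤ) j = (-1) ^ j * (j + 1) := by
    rw [show (-1 - 1 : ℤ) = -2 by norm_num, Ring.choose_neg', Ring.multichoose_two]
    simp [Int.negOnePow_def, Units.smul_def, mul_add]
  rw [this]
  have h1 : m - 2 - (-1 - (1 : ℕ) - (j : ℤ)) = m + j := by simp; ring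
  have h2 : -1 - 1 + m - (j : ℤ) = m - 2 - j := by ring
  rw [h1, h2]
  push_cast
  rw [← mul_assoc, neg_one_pow_mul_self]
  have h3 : (-1 : ℂ) ^ (-2 : ℤ) = 1 := by norm_num
  rw [h3]
  simp only [LinearMap.smul_apply, LinearMap.sub_apply, one_smul]
  module

theorem HasParity.opProd_zero (hΓ : Γ * Γ = 1) (hA : HasParity Γ e A) (hB : HasParity Γ f B) :
    HasParity Γ (e + f) (opProd Γ 0 A B) := by
  intro m
  ext v
  simp only [Module.End.mul_apply, LinearMap.smul_apply]
  rw [ncoeff_opProd_zero hΓ hA hB, ncoeff_opProd_zero hΓ hA hB,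
    map_finsum _ (finite_support_ord _ _ _ _ _),
    smul_finsum' _ (finite_support_ord _ _ _ _ _)]
  refine finsum_congr fun p => ?_
  have hA' (p u) := LinearMap.congr_fun (hA p) u
  have hB' (p u) := LinearMap.congr_fun (hB p) u
  simp only [Module.End.mul_apply, LinearMap.smul_apply] at hA' hB'
  unfold ord
  split_ifs
  · simp [hA', hB', smul_smul, pow_add]
  · simp only [LinearMap.smul_apply, Module.End.mul_apply, map_smul, hA', hB', smul_smul, pow_add]
    congr 1
    ring

end Parity

/-! ### Rearrangement of normally ordered products -/

section Rearrangement

variable {Γ : Module.End ℂ V} {a b c : ℕ} {A B C : VertexOperator ℂ V}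

theorem opProd_comm (hΓ : Γ * Γ = 1) (hA : HasParity Γ a A) (hB : HasParity Γ b B)
    (h : ∀ p q, A[[p]] * B[[q]] = (-1 : ℂ) ^ (a * b) • (B[[q]] * A[[p]])) :
    opProd Γ 0 A B = (-1 : ℂ) ^ (a * b) • opProd Γ 0 B A := by
  refine field_ext fun m v => ?_
  rw [map_smul, Pi.smul_apply, LinearMap.smul_apply, ncoeff_opProd_zero hΓ hA hB,
    ncoeff_opProd_zero hΓ hB hA, smul_finsum' _ (finite_support_ord _ _ _ _ _),
    ← finsum_comp_equiv (Equiv.subLeft (m - 1))]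
  refine finsum_congr fun p => ?_
  have h' : ord ((-1) ^ (a * b)) A B = fun p q => A[[p]] * B[[q]] := by
    ext1 p; ext1 q
    unfold ord
    split_ifs
    · rfl
    · exact (h p q).symm
  have h'' : ord ((-1) ^ (b * a)) B A = fun p q => B[[p]] * A[[q]] := by
    ext1 p; ext1 q
    unfold ord
    split_ifs
    · rfl
    · rw [h, smul_smul, mul_comm b, neg_one_pow_mul_self, one_smul]
  rw [h', h'']
  simp only [Equiv.subLeft_apply, sub_sub_cancel]
  rw [h]
  rfl

/-- The iterated normally ordered product of three modes. -/
def ord₃ (s t u : ℂ) (A B C : VertexOperator ℂ V) (p q r : ℤ) : Module.End ℂ V :=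
  if p < 0 then A[[p]] * ord u B C q r else (s * t) • (ord u B C q r * A[[p]])

theorem finite_support_ord₃ (s t u : ℂ) (A B C : VertexOperator ℂ V) (k : ℤ) (v : V) :
    Function.HasFiniteSupport fun x : ℤ × ℤ => ord₃ s t u A B C x.1 x.2 (k - x.1 - x.2) v := by
  obtain ⟨N, hN⟩ := exists_modes_eq_zero A v
  obtain ⟨M, hM⟩ := exists_ord_eq_zero u B C v
  refine finite_support_of_fibers _ (-|k - M|) (max N 0) (fun p hp q => ?_) fun p => ?_
  · rcases lt_or_ge p 0 with h0 | h0
    · have : M ≤ k - p := by grind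
      simp [ord₃, h0, hM _ this]
    · have : N ≤ p := by grind
      simp [ord₃, not_lt.2 h0, hN _ this]
  · rcases lt_or_ge p 0 with h0 | h0
    · exact finite_support_of_imp (finite_support_ord u B C (k - p) v)
        fun q hq => by simp [ord₃, h0, hq]
    · exact finite_support_of_imp (finite_support_ord u B C (k - p) ((A[[p]]) v))
        fun q hq => by simp [ord₃, not_lt.2 h0, hq]

theorem ncoeff_opProd_opProd (hΓ : Γ * Γ = 1) (hA : HasParity Γ a A) (hB : HasParity Γ b B)
    (hC : HasParity Γ c C) (m : ℤ) (v : V) :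
    ((opProd Γ 0 A (opProd Γ 0 B C))[[m]]) v = ∑ᶠ x : ℤ × ℤ,
      ord₃ ((-1) ^ (a * b)) ((-1) ^ (a * c)) ((-1) ^ (b * c)) A B C
        x.1 x.2 (m - 2 - x.1 - x.2) v := by
  rw [finsum_curry _ (finite_support_ord₃ _ _ _ _ _ _ _ _),
    ncoeff_opProd_zero hΓ hA (hB.opProd_zero hΓ hC)]
  refine finsum_congr fun p => ?_
  have e : m - 1 - p - 1 = m - 2 - p := by ring
  rcases lt_or_ge p 0 with h0 | h0
  · rw [ord_of_neg _ _ _ h0, Module.End.mul_apply, ncoeff_opProd_zero hΓ hB hC,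
      map_finsum _ (finite_support_ord _ _ _ _ _)]
    simp [ord₃, h0, e]
  · rw [ord_of_nonneg _ _ _ h0, LinearMap.smul_apply, Module.End.mul_apply,
      ncoeff_opProd_zero hΓ hB hC, smul_finsum' _ (finite_support_ord _ _ _ _ _)]
    simp [ord₃, not_lt.2 h0, e, mul_add, pow_add]

/-- Nesting already places the nonnegative modes of A and B to the right of the negative ones. If p
and q lie on opposite sides of 0, both nestings produce the same order, so A and B need not commute
there. -/
theorem opProd_left_comm (hΓ : Γ * Γ = 1) (hA : HasParity Γ a A) (hB : HasParity Γ b B)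
    (hC : HasParity Γ c C)
    (h : ∀ p q, (p < 0 ↔ q < 0) → A[[p]] * B[[q]] = (-1 : ℂ) ^ (a * b) • (B[[q]] * A[[p]])) :
    opProd Γ 0 A (opProd Γ 0 B C) = (-1 : ℂ) ^ (a * b) • opProd Γ 0 B (opProd Γ 0 A C) := by
  refine field_ext fun m v => ?_
  rw [map_smul, Pi.smul_apply, LinearMap.smul_apply, ncoeff_opProd_opProd hΓ hA hB hC,
    ncoeff_opProd_opProd hΓ hB hA hC, smul_finsum' _ (finite_support_ord₃ _ _ _ _ _ _ _ _),
    ← finsum_comp_equiv (Equiv.prodComm ℤ ℤ)]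
  refine finsum_congr fun x => ?_
  obtain ⟨p, q⟩ := x
  have e : m - 2 - q - p = m - 2 - p - q := by ring
  have h1 := neg_one_pow_mul_self (a * b)
  simp only [Equiv.prodComm_apply, Prod.swap_prod_mk, e, mul_comm b a]
  rw [← LinearMap.smul_apply]
  congr 1
  generalize (-1 : ℂ) ^ (a * b) = s at *
  have key (h' : q < 0 ↔ p < 0) : A[[q]] * B[[p]] = s • (B[[p]] * A[[q]]) := h q p h'
  unfold ord₃ ord
  rcases lt_or_ge p 0 with hp | hp <;> rcases lt_or_ge q 0 with hq | hq
  · have key := key (by simp [hp, hq])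
    simp only [hp, hq, if_true]
    rw [← mul_assoc, key, smul_mul_assoc, mul_assoc]
  · simp only [hp, not_lt.2 hq, if_true, if_false, mul_smul_comm, smul_smul, mul_assoc]
  · simp only [hq, not_lt.2 hp, if_true, if_false, mul_smul_comm, smul_smul, mul_assoc]
    rw [← mul_assoc s s, h1, one_mul]
  · have key := key (by simp [not_lt.2 hp, not_lt.2 hq])
    simp only [not_lt.2 hp, not_lt.2 hq, if_false, smul_mul_assoc, smul_smul, mul_assoc]
    rw [key, mul_smul_comm, smul_smul]
    congr 1
    linear_combination (-(-1 : ℂ) ^ (a * c) * (-1) ^ (b * c) * s) * h1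

/-- The mode of the composite AB has index p + q + 1, and its sign decides on which side C stands.
When p and q have opposite signs, this is the wrong side for exactly one of the two factors; moving
C past that factor costs one contraction, with the sign recorded by `step`. -/
theorem ord_mul_eq {s t u : ℂ} (hs : s * s = 1) (p q r : ℤ)
    {A' B' : VertexOperator ℂ V}
    (hAC : A[[p]] * C[[r]] = t • (C[[r]] * A[[p]]) + A'[[p + r]])
    (hBC : B[[q]] * C[[r]] = u • (C[[r]] * B[[q]]) + B'[[q + r]]) :
    (if p + q + 1 < 0 then ord s A B p q * C[[r]] else (t * u) • (C[[r]] * ord s A B p q)) =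
      ord₃ s t u A B C p q r + step p q • ord (s * t) A B' p (q + r)
        + step q p • s • ord (s * u) B A' q (p + r) := by
  rw [← sub_eq_iff_eq_add'] at hAC hBC
  unfold ord₃ ord
  rw [← hAC, ← hBC]
  generalize A[[p]] = x
  generalize B[[q]] = y
  generalize C[[r]] = z
  have p₁ (p q : ℤ) (h : 0 ≤ q ∧ q < -1 - p) : step p q = 1 := by
    rw [step, if_pos h, if_neg (by omega), sub_zero]
  have p₂ (p q : ℤ) (h : -1 - p ≤ q ∧ q < 0) : step p q = -1 := by
    rw [step, if_pos h, if_neg (by omega), zero_sub]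
  have p₃ (p q : ℤ) (h : ¬ (0 ≤ q ∧ q < -1 - p)) (h' : ¬ (-1 - p ≤ q ∧ q < 0)) :
      step p q = 0 := by
    rw [step, if_neg h, if_neg h', sub_zero]
  rcases lt_or_ge p 0 with hp | hp <;> rcases lt_or_ge q 0 with hq | hq <;>
    rcases lt_or_ge (p + q + 1) 0 with hl | hl
  · rw [p₃ p q (by omega) (by omega), p₃ q p (by omega) (by omega)]
    simp [hp, hq, hl, mul_assoc]
  · omega
  · rw [p₁ p q (by omega), p₃ q p (by omega) (by omega)]
    simp [hp, not_lt.2 hq, hl, mul_assoc, mul_sub]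
  · rw [p₃ p q (by omega) (by omega), p₂ q p (by omega)]
    simp [hp, not_lt.2 hq, not_lt.2 hl, mul_assoc, mul_sub, sub_mul, smul_sub, smul_smul]
    match_scalars
    · linear_combination (-(t * u)) * hs
    · linear_combination u * hs
  · rw [p₃ p q (by omega) (by omega), p₁ q p (by omega)]
    simp [hq, not_lt.2 hp, hl, mul_assoc, mul_sub, smul_sub, smul_smul]
  · rw [p₂ p q (by omega), p₃ q p (by omega) (by omega)]
    simp [hq, not_lt.2 hp, not_lt.2 hl, mul_assoc, mul_sub, sub_mul, smul_sub, smul_smul]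
    match_scalars
    ring
  · omega
  · rw [p₃ p q (by omega) (by omega), p₃ q p (by omega) (by omega)]
    simp [not_lt.2 hp, not_lt.2 hq, not_lt.2 hl, mul_assoc, smul_smul]
    match_scalars
    ring

/-- Sum `ord_mul_eq` over all modes of fixed total index. In the first correction the index q + r =
m - 2 - p of B' does not involve q, so summing `step` over q yields the weight -1 - p of ( )₋₁; the
second is the same with A and B exchanged. -/
theorem opProd_opProd_eq (hΓ : Γ * Γ = 1) (hA : HasParity Γ a A) (hB : HasParity Γ b B)
    (hC : HasParity Γ c C) {A' B' : VertexOperator ℂ V} (hA' : HasParity Γ (a + c) A')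
    (hB' : HasParity Γ (b + c) B')
    (hAC : ∀ p r, A[[p]] * C[[r]] = (-1 : ℂ) ^ (a * c) • (C[[r]] * A[[p]]) + A'[[p + r]])
    (hBC : ∀ q r, B[[q]] * C[[r]] = (-1 : ℂ) ^ (b * c) • (C[[r]] * B[[q]]) + B'[[q + r]]) :
    opProd Γ 0 (opProd Γ 0 A B) C = opProd Γ 0 A (opProd Γ 0 B C) + opProd Γ (-1) A B'
      + (-1 : ℂ) ^ (a * b) • opProd Γ (-1) B A' := by
  refine field_ext fun m v => ?_
  have e (p q : ℤ) : m - 1 - (p + q + 1) = m - 2 - p - q := by ring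
  -- the left hand side as a sum over pairs of modes
  let s : ℂ := (-1) ^ (a * b)
  let t : ℂ := (-1) ^ (a * c)
  let u : ℂ := (-1) ^ (b * c)
  have hs : s * s = 1 := neg_one_pow_mul_self _
  let g : ℤ × ℤ → V := fun x =>
    if x.1 < 0 then ord s A B x.2 (x.1 - 1 - x.2) ((C[[m - 1 - x.1]]) v)
    else (t * u) • (C[[m - 1 - x.1]]) (ord s A B x.2 (x.1 - 1 - x.2) v)
  have hg : g.HasFiniteSupport := by
    obtain ⟨N, hN⟩ := exists_ord_eq_zero s A B v
    obtain ⟨M, hM⟩ := exists_modes_eq_zero C v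
    refine finite_support_of_fibers _ (-|m - 1 - M|) (max (N + 1) 0) (fun p hp q => ?_) fun p => ?_
    · rcases lt_or_ge p 0 with h0 | h0
      · have : M ≤ m - 1 - p := by grind
        simp [g, h0, hM _ this]
      · have : N ≤ p - 1 := by grind
        simp [g, not_lt.2 h0, hN _ this]
    · rcases lt_or_ge p 0 with h0 | h0
      · exact finite_support_of_imp (finite_support_ord s A B (p - 1) ((C[[m - 1 - p]]) v))
          fun q hq => by simp [g, h0, hq]
      · exact finite_support_of_imp (finite_support_ord s A B (p - 1) v)
          fun q hq => by simp [g, not_lt.2 h0, hq]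
  have hL : ((opProd Γ 0 (opProd Γ 0 A B) C)[[m]]) v = ∑ᶠ x, g x := by
    rw [finsum_curry _ hg, ncoeff_opProd_zero hΓ (hA.opProd_zero hΓ hB) hC]
    refine finsum_congr fun p => ?_
    rcases lt_or_ge p 0 with h0 | h0
    · rw [ord_of_neg _ _ _ h0, Module.End.mul_apply, ncoeff_opProd_zero hΓ hA hB]
      simp [g, h0, s]
    · rw [ord_of_nonneg _ _ _ h0, LinearMap.smul_apply, Module.End.mul_apply,
        ncoeff_opProd_zero hΓ hA hB, map_finsum _ (finite_support_ord _ _ _ _ _),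
        smul_finsum' _ (finite_support_of_imp (finite_support_ord s A B (p - 1) v)
          fun q hq => by simp [s] at hq; simp [hq])]
      simp [g, not_lt.2 h0, s, t, u, add_mul, pow_add]
  -- The left side is indexed by the mode of the composite AB and that of A, the right side by the
  -- modes of A and B; `E` translates, with the shift by 1 from the mode convention.
  let E : ℤ × ℤ ≃ ℤ × ℤ :=
    { toFun := fun x => (x.1 + x.2 + 1, x.1)
      invFun := fun y => (y.2, y.1 - 1 - y.2)
      left_inv := fun x => by ext <;> simp
      right_inv := fun x => by ext <;> simp }
  -- the two corrections
  let h₁ : ℤ × ℤ → V := fun x => step x.1 x.2 • ord (s * t) A B' x.1 (m - 2 - x.1) v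
  let h₂ : ℤ × ℤ → V := fun x => step x.1 x.2 • s • ord (s * u) B A' x.1 (m - 2 - x.1) v
  have hfin (w : ℂ) (F G : VertexOperator ℂ V) : Function.HasFiniteSupport fun x : ℤ × ℤ =>
      step x.1 x.2 • ord w F G x.1 (m - 2 - x.1) v := by
    obtain ⟨N, hN⟩ := exists_modes_eq_zero F v
    obtain ⟨M, hM⟩ := exists_modes_eq_zero G v
    refine finite_support_of_fibers _ (-|m - 2 - M|) (max N 0) (fun p hp q => ?_) fun p =>
      finite_support_step p (ord w F G p (m - 2 - p) v)
    rcases lt_or_ge p 0 with h0 | h0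
    · have : M ≤ m - 2 - p := by grind
      simp [ord, h0, hM _ this]
    · have : N ≤ p := by grind
      simp [ord, not_lt.2 h0, hN _ this]
  have hh₁ : h₁.HasFiniteSupport := hfin _ _ _
  have hh₂ : h₂.HasFiniteSupport := finite_support_of_imp (hfin (s * u) B A') fun x hx => by
    simp only [h₂]
    rw [smul_comm, hx, smul_zero]
  have hR₁ : ((opProd Γ (-1) A B')[[m]]) v = ∑ᶠ x, h₁ x := by
    rw [finsum_curry _ hh₁, ncoeff_opProd_neg_one hΓ hA hB']
    refine finsum_congr fun p => ?_
    simp only [h₁]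
    rw [finsum_step]
    simp [s, t, mul_add, pow_add]
  have hR₂ : (((-1 : ℂ) ^ (a * b) • opProd Γ (-1) B A')[[m]]) v = ∑ᶠ x, h₂ x := by
    rw [finsum_curry _ hh₂, map_smul, Pi.smul_apply, LinearMap.smul_apply,
      ncoeff_opProd_neg_one hΓ hB hA', smul_finsum' _ (finite_support_of_imp
        (finite_support_ord _ B A' (m - 2) v) fun p hp => by rw [hp, smul_zero])]
    refine finsum_congr fun p => ?_
    simp only [h₂]
    rw [finsum_step, smul_comm]
    simp [s, u, mul_add, pow_add, mul_comm b a]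
  have hgE : (fun x => g (E x)).HasFiniteSupport := Set.Finite.preimage E.injective.injOn hg
  have hhS : (fun x : ℤ × ℤ => h₂ (Equiv.prodComm ℤ ℤ x)).HasFiniteSupport :=
    Set.Finite.preimage (Equiv.prodComm ℤ ℤ).injective.injOn hh₂
  rw [map_add, map_add, Pi.add_apply, Pi.add_apply, LinearMap.add_apply, LinearMap.add_apply,
    hR₁, hR₂, hL, ncoeff_opProd_opProd hΓ hA hB hC, ← finsum_comp_equiv E,
    ← finsum_comp_equiv (Equiv.prodComm ℤ ℤ) (f := h₂),
    ← finsum_add_distrib (finite_support_ord₃ _ _ _ _ _ _ _ _) hh₁, ← finsum_add_distrib _ hhS]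
  · refine finsum_congr fun x => ?_
    obtain ⟨p, q⟩ := x
    have key := LinearMap.congr_fun (ord_mul_eq hs p q (m - 2 - p - q) (hAC p _) (hBC q _)) v
    have e₁ : q + (m - 2 - p - q) = m - 2 - p := by ring
    have e₂ : p + (m - 2 - p - q) = m - 2 - q := by ring
    have e₃ : p + q + 1 - 1 - p = q := by ring
    rw [e₁, e₂] at key
    simp only [LinearMap.add_apply, LinearMap.smul_apply] at key
    simp only [Equiv.prodComm_apply, Prod.swap_prod_mk, h₁, h₂]
    refine Eq.trans ?_ key
    simp only [g, E, Equiv.coe_fn_mk, e, e₃]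
    split_ifs <;> rfl
  · exact Set.Finite.subset (Set.Finite.union (finite_support_ord₃ s t u A B C (m - 2) v) hh₁)
      (Function.support_add _ _)

end Rearrangement

/-! ### Bilinearity of the products -/

theorem hasFiniteSupport_prodTerm (Γ : Module.End ℂ V) (r : ℤ) (A B : VertexOperator ℂ V)
    (m : ℤ) (v : V) : Function.HasFiniteSupport fun j => prodTerm Γ r A B m j v :=
  finite_support_prodTerm Γ r A B m v

theorem ncoeff_opProd (Γ : Module.End ℂ V) (p : ℤ) (A B : VertexOperator ℂ V) (m : ℤ) (v : V) :
    ((opProd Γ p A B)[[m]]) v = ∑ᶠ j : ℕ, prodTerm Γ (p - 1) A B m j v := by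
  rw [opProd, ncoeff_ofModes]
  rfl

theorem ncoeff_add_apply (A B : VertexOperator ℂ V) (m : ℤ) (v : V) :
    ((A + B)[[m]]) v = (A[[m]]) v + (B[[m]]) v := by
  rw [map_add]; rfl

theorem ncoeff_smul_apply (c : ℂ) (A : VertexOperator ℂ V) (m : ℤ) (v : V) :
    ((c • A)[[m]]) v = c • (A[[m]]) v := by
  rw [map_smul]; rfl

/-- The product `(A B)_p` as a bilinear map. -/
noncomputable def opProdₗ (Γ : Module.End ℂ V) (p : ℤ) :
    VertexOperator ℂ V →ₗ[ℂ] VertexOperator ℂ V →ₗ[ℂ] VertexOperator ℂ V :=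
  LinearMap.mk₂ ℂ (opProd Γ p)
    (fun A A' B => by
      refine field_ext fun m v => ?_
      simp only [ncoeff_add_apply, ncoeff_opProd]
      rw [← finsum_add_distrib (hasFiniteSupport_prodTerm _ _ _ _ _ _)
        (hasFiniteSupport_prodTerm _ _ _ _ _ _)]
      refine finsum_congr fun j => ?_
      rw [← LinearMap.add_apply]
      congr 1
      simp only [prodTerm, swapMul, evenPart, oddPart, map_add, Pi.add_apply, mul_add, add_mul,
        mul_sub, mul_smul_comm]
      module)
    (fun c A B => by
      refine field_ext fun m v => ?_
      simp only [ncoeff_smul_apply, ncoeff_opProd]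
      rw [smul_finsum' _ (hasFiniteSupport_prodTerm _ _ _ _ _ _)]
      refine finsum_congr fun j => ?_
      rw [← LinearMap.smul_apply]
      congr 1
      simp only [prodTerm, swapMul, evenPart, oddPart, map_smul, Pi.smul_apply, mul_sub, mul_add,
        mul_smul_comm, smul_mul_assoc]
      module)
    (fun A B B' => by
      refine field_ext fun m v => ?_
      simp only [ncoeff_add_apply, ncoeff_opProd]
      rw [← finsum_add_distrib (hasFiniteSupport_prodTerm _ _ _ _ _ _)
        (hasFiniteSupport_prodTerm _ _ _ _ _ _)]
      refine finsum_congr fun j => ?_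
      rw [← LinearMap.add_apply]
      congr 1
      simp only [prodTerm, swapMul, map_add, Pi.add_apply, mul_add, add_mul]
      module)
    (fun c A B => by
      refine field_ext fun m v => ?_
      simp only [ncoeff_smul_apply, ncoeff_opProd]
      rw [smul_finsum' _ (hasFiniteSupport_prodTerm _ _ _ _ _ _)]
      refine finsum_congr fun j => ?_
      rw [← LinearMap.smul_apply]
      congr 1
      simp only [prodTerm, swapMul, map_smul, Pi.smul_apply, mul_smul_comm, smul_mul_assoc]
      module)

theorem opProdₗ_apply (Γ : Module.End ℂ V) (p : ℤ) (A B : VertexOperator ℂ V) :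
    opProdₗ Γ p A B = opProd Γ p A B := rfl

/-! ### Commutators with normally ordered products -/

variable {Γ : Module.End ℂ V} {e a b : ℕ} {F A B : VertexOperator ℂ V}

/-- A scalar contraction with one factor leaves the other factor. The conditions `hκ` and `hμ` let a
nonzero contraction occur only where the sign of moving the remaining factor is trivial, so creation
and annihilation halves give the same result. -/
theorem mode_mul_opProd_zero (hΓ : Γ * Γ = 1) (hA : HasParity Γ a A) (hB : HasParity Γ b B)
    (κ μ : ℂ) (hκ : κ * ((-1) ^ (a * b) * (-1) ^ (e * b)) = κ)
    (hμ : μ * ((-1) ^ (a * b) * (-1) ^ (e * a)) = μ)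
    (hFA : ∀ q p, F[[q]] * A[[p]] = (-1 : ℂ) ^ (e * a) • (A[[p]] * F[[q]])
      + (if q + p = -1 then κ else 0) • 1)
    (hFB : ∀ q p, F[[q]] * B[[p]] = (-1 : ℂ) ^ (e * b) • (B[[p]] * F[[q]])
      + (if q + p = -1 then μ else 0) • 1) (q m : ℤ) :
    F[[q]] * (opProd Γ 0 A B)[[m]] =
      (-1 : ℂ) ^ (e * (a + b)) • ((opProd Γ 0 A B)[[m]] * F[[q]])
        + (κ • B[[q + m]] + ((-1 : ℂ) ^ (e * a) * μ) • A[[q + m]]) := by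
  ext v
  simp only [LinearMap.add_apply, LinearMap.smul_apply, Module.End.mul_apply]
  rw [ncoeff_opProd_zero hΓ hA hB, ncoeff_opProd_zero hΓ hA hB,
    map_finsum _ (finite_support_ord _ _ _ _ _), smul_finsum' _ (finite_support_ord _ _ _ _ _)]
  have h₁ : ∑ᶠ p : ℤ, (if q + p = -1 then κ else 0) • (B[[m - 1 - p]]) v =
      κ • (B[[q + m]]) v := by
    rw [finsum_eq_single _ (-1 - q) fun p hp => by rw [if_neg (by omega), zero_smul],
      if_pos (by ring), show m - 1 - (-1 - q) = q + m by ring]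
  have h₂ : ∑ᶠ p : ℤ, (if q + (m - 1 - p) = -1 then (-1) ^ (e * a) * μ else 0) • (A[[p]]) v =
      ((-1) ^ (e * a) * μ) • (A[[q + m]]) v := by
    rw [finsum_eq_single _ (q + m) fun p hp => by rw [if_neg (by omega), zero_smul],
      if_pos (by ring)]
  have f₁ : Function.HasFiniteSupport fun p : ℤ =>
      (if q + p = -1 then κ else 0) • (B[[m - 1 - p]]) v :=
    (Set.finite_singleton (-1 - q)).subset fun p hp => by
      by_contra h
      exact hp (by simp only [Set.mem_singleton_iff] at h; simp only; rw [if_neg (by omega), zero_smul])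
  have f₂ : Function.HasFiniteSupport fun p : ℤ =>
      (if q + (m - 1 - p) = -1 then (-1) ^ (e * a) * μ else 0) • (A[[p]]) v :=
    (Set.finite_singleton (q + m)).subset fun p hp => by
      by_contra h
      exact hp (by simp only [Set.mem_singleton_iff] at h; simp only; rw [if_neg (by omega), zero_smul])
  have f₃ := finite_support_ord ((-1) ^ (a * b)) A B (m - 1) ((F[[q]]) v)
  rw [← h₁, ← h₂, ← finsum_add_distrib f₁ f₂, ← finsum_add_distrib
    (finite_support_of_imp f₃ fun p hp => by rw [hp, smul_zero])
    (Set.Finite.subset (Set.Finite.union f₁ f₂) (Function.support_add _ _))]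
  refine finsum_congr fun p => ?_
  have hA' (p u) := LinearMap.congr_fun (hFA q p) u
  have hB' (p u) := LinearMap.congr_fun (hFB q p) u
  simp only [Module.End.mul_apply, LinearMap.smul_apply, LinearMap.add_apply,
    Module.End.one_apply] at hA' hB'
  rcases lt_or_ge p 0 with h0 | h0
  · rw [ord_of_neg _ _ _ h0, Module.End.mul_apply, hA', hB']
    simp only [map_add, map_smul, Module.End.mul_apply, mul_add, pow_add]
    split_ifs <;> module
  · rw [ord_of_nonneg _ _ _ h0, LinearMap.smul_apply, Module.End.mul_apply, map_smul, hB', hA']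
    have hk : (if q + p = -1 then κ else 0) * ((-1) ^ (a * b) * (-1) ^ (e * b)) =
        if q + p = -1 then κ else 0 := by
      split_ifs
      exacts [hκ, zero_mul _]
    have hl : (if q + (m - 1 - p) = -1 then (-1) ^ (e * a) * μ else 0) =
        (-1) ^ (a * b) * if q + (m - 1 - p) = -1 then μ else 0 := by
      split_ifs
      · linear_combination (-(-1) ^ (e * a)) * hμ
          + μ * (-1) ^ (a * b) * neg_one_pow_mul_self (e * a)
      · rw [mul_zero]
    rw [hl]
    simp only [map_add, map_smul, Module.End.mul_apply, LinearMap.smul_apply, mul_add, pow_add]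
    match_scalars
    · ring
    · linear_combination hk
    · ring

theorem mode_mul_opProd_zero_of_commute (hΓ : Γ * Γ = 1) (hA : HasParity Γ a A)
    (hB : HasParity Γ b B)
    (hFA : ∀ q p, F[[q]] * A[[p]] = (-1 : ℂ) ^ (e * a) • (A[[p]] * F[[q]]))
    (hFB : ∀ q p, F[[q]] * B[[p]] = (-1 : ℂ) ^ (e * b) • (B[[p]] * F[[q]])) (q m : ℤ) :
    F[[q]] * (opProd Γ 0 A B)[[m]] =
      (-1 : ℂ) ^ (e * (a + b)) • ((opProd Γ 0 A B)[[m]] * F[[q]]) := by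
  have := mode_mul_opProd_zero hΓ hA hB 0 0 (by simp) (by simp)
    (fun q p => by simpa using hFA q p) (fun q p => by simpa using hFB q p) q m
  simpa using this

theorem ncoeff_opProd_one (hΓ : Γ * Γ = 1) (hA : HasParity Γ a A) (hB : HasParity Γ b B) (m : ℤ) :
    (opProd Γ 1 A B)[[m]] = A[[0]] * B[[m]] - (-1 : ℂ) ^ (a * b) • (B[[m]] * A[[0]]) := by
  ext v
  rw [ncoeff_opProd, finsum_eq_single _ 0 fun j hj => ?_]
  · simp [prodTerm, swapMul_eq hΓ (hA _) (hB _)]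
  · have : Ring.choose (1 - 1 : ℤ) j = 0 := by
      rw [sub_self, Ring.choose_zero_pos _ (Nat.pos_of_ne_zero hj)]
    rw [prodTerm, this]
    simp

theorem HasParity.opProd_one (hΓ : Γ * Γ = 1) (hA : HasParity Γ a A) (hB : HasParity Γ b B) :
    HasParity Γ (a + b) (opProd Γ 1 A B) := by
  intro m
  rw [ncoeff_opProd_one hΓ hA hB, mul_sub, sub_mul, mul_smul_comm, ← mul_assoc, ← mul_assoc, hA, hB,
    smul_mul_assoc, smul_mul_assoc, mul_assoc, mul_assoc, hA, hB]
  simp only [mul_smul_comm, smul_mul_assoc, mul_assoc, pow_add]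
  module

/-- The zero mode of F acts as a superderivation, and the term in which it hits B vanishes. -/
theorem opProd_one_opProd_zero (hΓ : Γ * Γ = 1) (hF : HasParity Γ e F) (hA : HasParity Γ a A)
    (hB : HasParity Γ 0 B) (hFB : ∀ p, F[[0]] * B[[p]] = B[[p]] * F[[0]]) :
    opProd Γ 1 F (opProd Γ 0 A B) = opProd Γ 0 (opProd Γ 1 F A) B := by
  refine field_ext fun m v => ?_
  rw [ncoeff_opProd_one hΓ hF (hA.opProd_zero hΓ hB),
    ncoeff_opProd_zero hΓ (hF.opProd_one hΓ hA) hB]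
  simp only [LinearMap.sub_apply, LinearMap.smul_apply, Module.End.mul_apply]
  have f₁ := finite_support_ord ((-1) ^ (a * 0)) A B (m - 1) v
  have f₂ := finite_support_ord ((-1) ^ (a * 0)) A B (m - 1) ((F[[0]]) v)
  rw [ncoeff_opProd_zero hΓ hA hB, ncoeff_opProd_zero hΓ hA hB,
    map_finsum _ f₁, smul_finsum' _ f₂, ← finsum_sub_distrib
    (finite_support_of_imp f₁ fun p hp => by rw [hp, map_zero])
    (finite_support_of_imp f₂ fun p hp => by rw [hp, smul_zero])]
  refine finsum_congr fun p => ?_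
  have hB' (p u) := LinearMap.congr_fun (hFB p) u
  simp only [Module.End.mul_apply] at hB'
  rcases lt_or_ge p 0 with h0 | h0
  · rw [ord_of_neg _ _ _ h0, ord_of_neg _ _ _ h0, ncoeff_opProd_one hΓ hF hA]
    simp [hB']
  · rw [ord_of_nonneg _ _ _ h0, ord_of_nonneg _ _ _ h0, ncoeff_opProd_one hΓ hF hA]
    simp [hB']

end Fields
/-! ### The generating fields -/

variable {n : ℕ}

theorem parity_mul_parity (n : ℕ) : parity n * parity n = 1 := by
  rw [parity, Module.End.mul_eq_comp, ← LinearMap.lTensor_comp]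
  have : (CliffordAlgebra.involute
      (Q := (0 : QuadraticForm ℂ (Fermion n × ℕ →₀ ℂ)))).toLinearMap ∘ₗ
      (CliffordAlgebra.involute
        (Q := (0 : QuadraticForm ℂ (Fermion n × ℕ →₀ ℂ)))).toLinearMap = LinearMap.id :=
    LinearMap.ext CliffordAlgebra.involute_involute
  rw [this, LinearMap.lTensor_id]
  rfl

/-- Contraction lowers the degree by one; this makes the annihilation modes of the fermions odd. -/
theorem involute_contractLeft {R M : Type*} [CommRing R] [AddCommGroup M] [Module R M]
    {Q : QuadraticForm R M} (d : Module.Dual R M) (x : CliffordAlgebra Q) :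
    CliffordAlgebra.involute (CliffordAlgebra.contractLeft d x) =
      -CliffordAlgebra.contractLeft d (CliffordAlgebra.involute x) := by
  induction x using CliffordAlgebra.left_induction with
  | algebraMap r => simp
  | add x y hx hy => simp only [map_add, hx, hy, neg_add]
  | ι_mul x u hx =>
    simp only [CliffordAlgebra.contractLeft_ι_mul, map_sub, map_mul, map_smul,
      CliffordAlgebra.involute_ι, hx, neg_mul, map_neg]
    simp

theorem ncoeff_bosonField (φ : Boson n) (m : ℤ) :
    (bosonField φ)[[m]] = LinearMap.rTensor (FermionFock n) (bosonMode φ m) :=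
  ncoeff_ofModes _ _ _

theorem ncoeff_fermionField (φ : Fermion n) (m : ℤ) :
    (fermionField φ)[[m]] = LinearMap.lTensor (BosonFock n) (fermionMode φ m) :=
  ncoeff_ofModes _ _ _

theorem hasParity_bosonField (φ : Boson n) : HasParity (parity n) 0 (bosonField φ) := fun m => by
  rw [ncoeff_bosonField, parity, pow_zero, one_smul, Module.End.mul_eq_comp,
    Module.End.mul_eq_comp, LinearMap.lTensor_comp_rTensor, LinearMap.rTensor_comp_lTensor]

theorem hasParity_fermionField (φ : Fermion n) : HasParity (parity n) 1 (fermionField φ) :=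
  fun m => by
    rw [ncoeff_fermionField, parity, pow_one, Module.End.mul_eq_comp,
      Module.End.mul_eq_comp, ← LinearMap.lTensor_comp, ← LinearMap.lTensor_comp,
      ← LinearMap.lTensor_smul]
    congr 1
    ext x
    rcases m with m | m
    · simp [fermionMode, involute_contractLeft]
    · simp [fermionMode, ExteriorAlgebra.ι]

theorem bosonField_mul_fermionField (φ : Boson n) (θ : Fermion n) (p q : ℤ) :
    (bosonField φ)[[p]] * (fermionField θ)[[q]] = (fermionField θ)[[q]] * (bosonField φ)[[p]] := by
  rw [ncoeff_bosonField, ncoeff_fermionField, Module.End.mul_eq_comp,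
    Module.End.mul_eq_comp, LinearMap.lTensor_comp_rTensor, LinearMap.rTensor_comp_lTensor]

/-- The residue of the operator product of two bosons. -/
noncomputable def bosonPairing : Boson n → Boson n → ℂ
  | .X i, .Y j => if i = j then 1 else 0
  | .Y i, .X j => if i = j then -1 else 0
  | _, _ => 0

theorem pderiv_X_mul {σ : Type*} [DecidableEq σ] (x y : σ) (f : MvPolynomial σ ℂ) :
    MvPolynomial.pderiv x (MvPolynomial.X y * f) =
      MvPolynomial.X y * MvPolynomial.pderiv x f + if x = y then f else 0 := by
  rw [MvPolynomial.pderiv_mul, add_comm]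
  congr 1
  by_cases h : x = y
  · subst h
    simp
  · rw [MvPolynomial.pderiv_X_of_ne (Ne.symm h), zero_mul, if_neg h]

theorem pderiv_pderiv_comm {σ : Type*} (x y : σ) (f : MvPolynomial σ ℂ) :
    MvPolynomial.pderiv x (MvPolynomial.pderiv y f) =
      MvPolynomial.pderiv y (MvPolynomial.pderiv x f) := by
  classical
  have h : ⁅MvPolynomial.pderiv x, MvPolynomial.pderiv (R := ℂ) y⁆ = 0 :=
    MvPolynomial.derivation_ext fun i => by
      rw [Derivation.commutator_apply, MvPolynomial.pderiv_X, MvPolynomial.pderiv_X,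
        Pi.single_apply, Pi.single_apply]
      split_ifs <;> simp
  have := DFunLike.congr_fun h f
  rw [Derivation.commutator_apply] at this
  exact sub_eq_zero.1 this

theorem bosonMode_mul_bosonMode (φ θ : Boson n) (p q : ℤ) :
    bosonMode φ p * bosonMode θ q =
      bosonMode θ q * bosonMode φ p + (if p + q = -1 then bosonPairing φ θ else 0) • 1 := by
  classical
  refine LinearMap.ext fun f => ?_
  simp only [LinearMap.add_apply, LinearMap.smul_apply, Module.End.mul_apply, Module.End.one_apply]
  rcases p with p | p <;> rcases q with q | q
  · rw [if_neg (by simp; omega), zero_smul, add_zero]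
    rcases φ with i | i <;> rcases θ with j | j <;>
      simp only [bosonMode, LinearMap.neg_apply,
        Derivation.coeFn_coe, map_neg] <;> rw [pderiv_pderiv_comm]
  · have h : (Int.ofNat p + Int.negSucc q = -1) ↔ p = q := by
      simp only [Int.negSucc_eq, Int.ofNat_eq_natCast]; omega
    rcases φ with i | i <;> rcases θ with j | j <;>
      simp only [bosonMode, LinearMap.neg_apply,
        Derivation.coeFn_coe, LinearMap.mulLeft_apply, pderiv_X_mul, Prod.mk.injEq, h,
        bosonPairing, reduceCtorEq, Boson.X.injEq, Boson.Y.injEq] <;>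
      split_ifs <;> simp_all [add_comm]
  · have h : (Int.negSucc p + Int.ofNat q = -1) ↔ q = p := by
      simp only [Int.negSucc_eq, Int.ofNat_eq_natCast]; omega
    rcases φ with i | i <;> rcases θ with j | j <;>
      simp only [bosonMode, LinearMap.neg_apply,
        Derivation.coeFn_coe, LinearMap.mulLeft_apply, pderiv_X_mul, Prod.mk.injEq, h,
        bosonPairing, reduceCtorEq, Boson.X.injEq, Boson.Y.injEq, eq_comm (a := i)] <;>
      split_ifs <;> simp_all
  · rw [if_neg (by simp only [Int.negSucc_eq]; omega), zero_smul, add_zero]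
    exact mul_left_comm (MvPolynomial.X (φ, p)) (MvPolynomial.X (θ, q)) f

theorem bosonField_mul_bosonField (φ θ : Boson n) (p q : ℤ) :
    (bosonField φ)[[p]] * (bosonField θ)[[q]] = (bosonField θ)[[q]] * (bosonField φ)[[p]]
      + (if p + q = -1 then bosonPairing φ θ else 0) • 1 := by
  simp only [ncoeff_bosonField, ← LinearMap.rTensor_mul, bosonMode_mul_bosonMode φ θ,
    LinearMap.rTensor_add, LinearMap.rTensor_smul]
  rw [Module.End.one_eq_id, LinearMap.rTensor_id]
  rfl

theorem Fermion.dual_dual (φ : Fermion n) : φ.dual.dual = φ := by cases φ <;> rfl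

/-- The residue of the operator product of two fermions. -/
noncomputable def fermionPairing (φ θ : Fermion n) : ℂ :=
  open Classical in if θ = φ.dual then 1 else 0

theorem fermionPairing_comm (φ θ : Fermion n) : fermionPairing φ θ = fermionPairing θ φ := by
  have : θ = φ.dual ↔ φ = θ.dual :=
    ⟨fun h => by rw [h, Fermion.dual_dual], fun h => by rw [h, Fermion.dual_dual]⟩
  unfold fermionPairing
  classical exact if_congr this rfl rfl

theorem contractLeft_single_mul (φ θ : Fermion n) (p q : ℕ) (x : FermionFock n) :
    fermionMode φ (Int.ofNat p) (fermionMode θ (Int.negSucc q) x) =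
      (if p = q then fermionPairing φ θ else 0) • x
        - fermionMode θ (Int.negSucc q) (fermionMode φ (Int.ofNat p) x) := by
  classical
  refine (CliffordAlgebra.contractLeft_ι_mul _ _ _).trans ?_
  congr 2
  simp only [Finsupp.lapply_apply, Finsupp.single_apply, Prod.mk.injEq, fermionPairing]
  split_ifs <;> simp_all

theorem fermionMode_mul_fermionMode (φ θ : Fermion n) (p q : ℤ) :
    fermionMode φ p * fermionMode θ q = (-1 : ℂ) ^ (1 * 1) • (fermionMode θ q * fermionMode φ p)
      + (if p + q = -1 then fermionPairing φ θ else 0) • 1 := by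
  refine LinearMap.ext fun x => ?_
  simp only [LinearMap.add_apply, LinearMap.smul_apply, Module.End.mul_apply,
    Module.End.one_apply, mul_one, pow_one, neg_smul, one_smul]
  rcases p with p | p <;> rcases q with q | q
  · rw [if_neg (by simp; omega), zero_smul, add_zero]
    exact CliffordAlgebra.contractLeft_comm ..
  · have h : (Int.ofNat p + Int.negSucc q = -1) ↔ p = q := by
      simp only [Int.negSucc_eq, Int.ofNat_eq_natCast]; omega
    rw [contractLeft_single_mul]
    simp only [h]
    abel
  · have h : (Int.negSucc p + Int.ofNat q = -1) ↔ q = p := by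
      simp only [Int.negSucc_eq, Int.ofNat_eq_natCast]; omega
    rw [contractLeft_single_mul, fermionPairing_comm]
    simp only [h]
    abel
  · rw [if_neg (by simp only [Int.negSucc_eq]; omega), zero_smul, add_zero]
    have := ExteriorAlgebra.ι_add_mul_swap (R := ℂ) (Finsupp.single (φ, p) (1 : ℂ))
      (Finsupp.single (θ, q) 1)
    rw [add_eq_zero_iff_eq_neg] at this
    simp only [fermionMode, LinearMap.mulLeft_apply, ← mul_assoc, this, neg_mul]

theorem fermionField_mul_fermionField (φ θ : Fermion n) (p q : ℤ) :
    (fermionField φ)[[p]] * (fermionField θ)[[q]] =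
      (-1 : ℂ) ^ (1 * 1) • ((fermionField θ)[[q]] * (fermionField φ)[[p]])
      + (if p + q = -1 then fermionPairing φ θ else 0) • 1 := by
  simp only [ncoeff_fermionField, ← LinearMap.lTensor_mul, fermionMode_mul_fermionMode φ θ,
    LinearMap.lTensor_add, LinearMap.lTensor_smul]
  rw [Module.End.one_eq_id, LinearMap.lTensor_id]
  rfl

/-! ### Products of quadratic composites -/

/-- The generating field with a given label. -/
noncomputable def gen : Boson n ⊕ Fermion n → VertexOperator ℂ (Fock n) :=
  Sum.elim bosonField fermionField

/-- The parity of a generator. -/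
def genParity : Boson n ⊕ Fermion n → ℕ :=
  Sum.elim (fun _ => 0) fun _ => 1

/-- The residue of the operator product of two generators. -/
noncomputable def genPairing : Boson n ⊕ Fermion n → Boson n ⊕ Fermion n → ℂ
  | .inl φ, .inl θ => bosonPairing φ θ
  | .inr φ, .inr θ => fermionPairing φ θ
  | _, _ => 0

theorem hasParity_gen (g : Boson n ⊕ Fermion n) : HasParity (parity n) (genParity g) (gen g) := by
  rcases g with φ | φ
  · exact hasParity_bosonField φ
  · exact hasParity_fermionField φ

theorem genParity_eq_of_pairing_ne_zero {g h : Boson n ⊕ Fermion n} (hgh : genPairing g h ≠ 0) :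
    genParity g = genParity h := by
  rcases g with φ | φ <;> rcases h with θ | θ <;> first | rfl | exact absurd rfl hgh

theorem gen_mul_gen (g h : Boson n ⊕ Fermion n) (p q : ℤ) :
    (gen g)[[p]] * (gen h)[[q]] =
      (-1 : ℂ) ^ (genParity g * genParity h) • ((gen h)[[q]] * (gen g)[[p]])
      + (if p + q = -1 then genPairing g h else 0) • 1 := by
  rcases g with φ | φ <;> rcases h with θ | θ
  · simpa [gen, genParity, genPairing] using bosonField_mul_bosonField φ θ p q
  · simpa [gen, genParity, genPairing] using bosonField_mul_fermionField φ θ p q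
  · simpa [gen, genParity, genPairing] using (bosonField_mul_fermionField θ φ q p).symm
  · exact fermionField_mul_fermionField φ θ p q

/-- The contraction of a generator with the normally ordered product of two generators. -/
noncomputable def contr (g k l : Boson n ⊕ Fermion n) : VertexOperator ℂ (Fock n) :=
  genPairing g k • gen l + ((-1 : ℂ) ^ (genParity g * genParity k) * genPairing g l) • gen k

/-- A nonzero pairing forces equal parities, so the two contracted generators contribute nothing to
the sign. -/
theorem hasParity_contr (g k l : Boson n ⊕ Fermion n) :
    HasParity (parity n) (genParity g + (genParity k + genParity l)) (contr g k l) := by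
  refine HasParity.add ?_ ?_
  · by_cases h : genPairing g k = 0
    · rw [h, zero_smul]
      exact HasParity.zero
    · rw [genParity_eq_of_pairing_ne_zero h]
      refine ((hasParity_gen l).congr ?_).smul _
      rw [← add_assoc, pow_add, pow_add, neg_one_pow_mul_self, one_mul]
  · by_cases h : genPairing g l = 0
    · rw [h, mul_zero, zero_smul]
      exact HasParity.zero
    · rw [genParity_eq_of_pairing_ne_zero h]
      refine ((hasParity_gen k).congr ?_).smul _
      rw [pow_add, pow_add, mul_left_comm, neg_one_pow_mul_self, mul_one]

theorem gen_mul_nop (g k l : Boson n ⊕ Fermion n) (q m : ℤ) :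
    (gen g)[[q]] * (nop (gen k) (gen l))[[m]] =
      (-1 : ℂ) ^ (genParity g * (genParity k + genParity l)) •
        ((nop (gen k) (gen l))[[m]] * (gen g)[[q]]) + (contr g k l)[[q + m]] := by
  rw [nop, mode_mul_opProd_zero (parity_mul_parity n) (hasParity_gen k) (hasParity_gen l)
    (genPairing g k) (genPairing g l) ?_ ?_ (gen_mul_gen g k) (gen_mul_gen g l), contr, map_add,
    map_smul, map_smul]
  · rfl
  · by_cases h : genPairing g k = 0
    · simp [h]
    · rw [genParity_eq_of_pairing_ne_zero h, neg_one_pow_mul_self, mul_one]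
  · by_cases h : genPairing g l = 0
    · simp [h]
    · rw [genParity_eq_of_pairing_ne_zero h, mul_comm (genParity l), neg_one_pow_mul_self, mul_one]

theorem nop_nop_gen (g h k l : Boson n ⊕ Fermion n) :
    nop (nop (gen g) (gen h)) (nop (gen k) (gen l)) =
      nop (gen g) (nop (gen h) (nop (gen k) (gen l)))
        + opProd (parity n) (-1) (gen g) (contr h k l)
        + (-1 : ℂ) ^ (genParity g * genParity h) •
          opProd (parity n) (-1) (gen h) (contr g k l) :=
  have hΓ := parity_mul_parity n
  opProd_opProd_eq hΓ (hasParity_gen g) (hasParity_gen h)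
    ((hasParity_gen k).opProd_zero hΓ (hasParity_gen l)) (hasParity_contr g k l)
    (hasParity_contr h k l) (gen_mul_nop g k l) (gen_mul_nop h k l)

theorem nop_comm_gen (g h : Boson n ⊕ Fermion n) (hgh : genPairing g h = 0) :
    nop (gen g) (gen h) = (-1 : ℂ) ^ (genParity g * genParity h) • nop (gen h) (gen g) :=
  opProd_comm (parity_mul_parity n) (hasParity_gen g) (hasParity_gen h) fun p q => by
    simpa [hgh] using gen_mul_gen g h p q

theorem nop_left_comm_gen (g h : Boson n ⊕ Fermion n) {c : ℕ} {C : VertexOperator ℂ (Fock n)}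
    (hC : HasParity (parity n) c C) :
    nop (gen g) (nop (gen h) C) =
      (-1 : ℂ) ^ (genParity g * genParity h) • nop (gen h) (nop (gen g) C) :=
  opProd_left_comm (parity_mul_parity n) (hasParity_gen g) (hasParity_gen h) hC fun p q hpq => by
    -- Two indices on the same side of 0 never sum to -1, so no contraction arises whatever the
    -- pairing.
    have : p + q ≠ -1 := by omega
    simpa [this] using gen_mul_gen g h p q

theorem nop_smul_right (c : ℂ) (A B : VertexOperator ℂ (Fock n)) : nop A (c • B) = c • nop A B :=
  map_smul (opProdₗ (parity n) 0 A) c B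

theorem nop_smul_left (c : ℂ) (A B : VertexOperator ℂ (Fock n)) : nop (c • A) B = c • nop A B :=
  LinearMap.congr_fun (map_smul (opProdₗ (parity n) 0) c A) B

theorem nop_add_right (A B C : VertexOperator ℂ (Fock n)) : nop A (B + C) = nop A B + nop A C :=
  map_add (opProdₗ (parity n) 0 A) B C

theorem nop_add_left (A B C : VertexOperator ℂ (Fock n)) : nop (A + B) C = nop A C + nop B C :=
  LinearMap.congr_fun (map_add (opProdₗ (parity n) 0) A B) C

theorem X_eq (i : Fin n) : X i = gen (.inl (.X i)) := rfl
theorem Y_eq (i : Fin n) : Y i = gen (.inl (.Y i)) := rfl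
theorem psi_eq (i : Fin n) : psi i = gen (.inr (.psi i)) := rfl
theorem chi_eq (i : Fin n) : chi i = gen (.inr (.chi i)) := rfl

theorem hasParity_nop_gen (g h : Boson n ⊕ Fermion n) :
    HasParity (parity n) (genParity g + genParity h) (nop (gen g) (gen h)) :=
  (hasParity_gen g).opProd_zero (parity_mul_parity n) (hasParity_gen h)

/-- Moving the inner ψ past χ leaves the square of the odd field χ, which vanishes because χ has no
contraction with itself. -/
theorem nop_psi_nop_chi_current (i : Fin n) :
    nop (psi i) (nop (chi i) (nop (psi i) (chi i))) = 0 := by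
  have h : nop (chi i) (chi i) = 0 := by
    have := nop_comm_gen (.inr (.chi i)) (.inr (.chi i))
      (by simp [genPairing, fermionPairing, Fermion.dual])
    simp only [genParity, Sum.elim_inr, mul_one, pow_one, ← chi_eq] at this
    have h2 : (2 : ℂ) • nop (chi i) (chi i) = 0 := by
      linear_combination (norm := module) this
    exact (smul_eq_zero.1 h2).resolve_left two_ne_zero
  have h' := nop_left_comm_gen (.inr (.chi i)) (.inr (.psi i)) (hasParity_gen (.inr (.chi i)))
  rw [← chi_eq, ← psi_eq, h] at h'
  rw [h']
  simp only [nop, ← opProdₗ_apply, map_zero, smul_zero]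

/-- The identity of composites behind the comparison of `Tᵢ` with `[Mᵢ⁺, Mᵢ⁻]`. -/
theorem quartic_identity (i : Fin n) :
    nop (nop (X i) (Y i)) (nop (X i) (Y i)) - nop (X i) (nop (Y i) (nop (X i) (Y i)))
      + (nop (Mplus i) (Mminus i) - nop (Mminus i) (Mplus i)) =
    nop (nop (X i) (Y i)) (nop (psi i) (chi i)) + nop (nop (psi i) (chi i)) (nop (X i) (Y i))
      + nop (nop (psi i) (chi i)) (nop (psi i) (chi i)) := by
  -- Corrections: the first difference gives -(XY)₋₁ + (YX)₋₁, and the commutator of M⁺ and M⁻ gives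
  -- (XY)₋₁ + (ψχ)₋₁ - (YX)₋₁ + (χψ)₋₁. The sum (ψχ)₋₁ + (χψ)₋₁ is exactly (ψχ)(ψχ).
  have h₁ := nop_nop_gen (.inl (.X i)) (.inl (.Y i)) (.inl (.X i)) (.inl (.Y i))
  have h₂ := nop_nop_gen (.inl (.X i)) (.inr (.psi i)) (.inl (.Y i)) (.inr (.chi i))
  have h₃ := nop_nop_gen (.inl (.Y i)) (.inr (.chi i)) (.inl (.X i)) (.inr (.psi i))
  have h₄ := nop_nop_gen (.inl (.X i)) (.inl (.Y i)) (.inr (.psi i)) (.inr (.chi i))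
  have h₅ := nop_nop_gen (.inr (.psi i)) (.inr (.chi i)) (.inl (.X i)) (.inl (.Y i))
  have h₆ := nop_nop_gen (.inr (.psi i)) (.inr (.chi i)) (.inr (.psi i)) (.inr (.chi i))
  simp only [contr, genPairing, bosonPairing, fermionPairing, Fermion.dual, genParity,
    Sum.elim_inl, Sum.elim_inr, if_true, reduceCtorEq, if_false, zero_smul, mul_zero, mul_one,
    add_zero, zero_add, pow_zero, pow_one, one_smul, ← X_eq, ← Y_eq, ← psi_eq, ← chi_eq,
    ← opProdₗ_apply (parity n) (-1), map_zero, map_smul, smul_zero] at h₁ h₂ h₃ h₄ h₅ h₆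
  rw [nop_psi_nop_chi_current] at h₆
  -- The uncorrected quartic terms are matched by X(ψ(Yχ)) = X(Y(ψχ)) and ψ(χ(XY)) = -Y(χ(Xψ)).
  have e₁ := nop_left_comm_gen (.inr (.psi i)) (.inl (.Y i)) (hasParity_gen (.inr (.chi i)))
  have e₂ := nop_left_comm_gen (.inr (.psi i)) (.inr (.chi i))
    (hasParity_nop_gen (.inl (.X i)) (.inl (.Y i)))
  have e₃ := nop_left_comm_gen (.inr (.psi i)) (.inl (.X i)) (hasParity_gen (.inl (.Y i)))
  have e₄ := nop_comm_gen (.inr (.psi i)) (.inl (.Y i)) rfl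
  have e₅ := nop_left_comm_gen (.inl (.X i)) (.inl (.Y i)) (hasParity_gen (.inr (.psi i)))
  have e₆ := nop_left_comm_gen (.inr (.chi i)) (.inl (.Y i))
    (hasParity_nop_gen (.inl (.X i)) (.inr (.psi i)))
  simp only [genParity, Sum.elim_inl, Sum.elim_inr, mul_zero, mul_one, pow_zero, pow_one,
    one_smul, ← X_eq, ← Y_eq, ← psi_eq, ← chi_eq] at e₁ e₂ e₃ e₄ e₅ e₆
  rw [e₄, e₅] at e₃
  rw [e₃, e₆] at e₂
  rw [e₁] at h₂
  rw [e₂] at h₅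
  simp only [Mplus, Mminus, h₁, h₂, h₃, h₄, h₅, h₆]
  module

/-! ### Cancellation of anomalies in a neutral current -/

section Fields

variable {V : Type*} [AddCommGroup V] [Module ℂ V]

/-- A charge commutes with a neutral current whose bosonic and fermionic anomalies cancel. -/
theorem mode_mul_current {Γ : Module.End ℂ V} (hΓ : Γ * Γ = 1) {F A B C D : VertexOperator ℂ V}
    (hA : HasParity Γ 0 A) (hB : HasParity Γ 0 B) (hC : HasParity Γ 1 C) (hD : HasParity Γ 1 D)
    (hFA : ∀ r p, F[[r]] * A[[p]] = A[[p]] * F[[r]] - A[[p + r]])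
    (hFB : ∀ r p, F[[r]] * B[[p]] = B[[p]] * F[[r]] + B[[p + r]])
    (hFC : ∀ r p, F[[r]] * C[[p]] = C[[p]] * F[[r]] + C[[p + r]])
    (hFD : ∀ r p, F[[r]] * D[[p]] = D[[p]] * F[[r]] - D[[p + r]])
    (h : ∀ x y, A[[x]] * B[[y]] - C[[x]] * D[[y]] = B[[y]] * A[[x]] + D[[y]] * C[[x]]) (r m : ℤ) :
    F[[r]] * (opProd Γ 0 A B + opProd Γ 0 C D)[[m]] =
      (opProd Γ 0 A B + opProd Γ 0 C D)[[m]] * F[[r]] := by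
  ext v
  simp only [Module.End.mul_apply, ncoeff_add_apply]
  simp only [ncoeff_opProd_zero hΓ hA hB, ncoeff_opProd_zero hΓ hC hD, map_add, mul_zero, pow_zero,
    mul_one, pow_one]
  have f₁ := finite_support_ord 1 A B (m - 1) v
  have f₂ := finite_support_ord (-1) C D (m - 1) v
  have f₃ := finite_support_ord 1 A B (m - 1) ((F[[r]]) v)
  have f₄ := finite_support_ord (-1) C D (m - 1) ((F[[r]]) v)
  -- The commutator telescopes into terms H p - H (p + r). The shift by r may carry a mode across 0,
  -- where the ordering prescription changes; hypothesis `h` makes H independent of the ordering, so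
  -- the shifted sums agree.
  let H : ℤ → V := fun p => ord 1 A B p (m + r - 1 - p) v - ord (-1) C D p (m + r - 1 - p) v
  have hH : H.HasFiniteSupport := Set.Finite.subset
    (Set.Finite.union (finite_support_ord 1 A B (m + r - 1) v)
      (finite_support_ord (-1) C D (m + r - 1) v)) (Function.support_sub _ _)
  have hH' : (fun p => H (p + r)).HasFiniteSupport :=
    Set.Finite.preimage (Equiv.addRight r).injective.injOn hH
  have hsum : ∑ᶠ p, (H p - H (p + r)) = 0 := by
    rw [finsum_sub_distrib hH hH', sub_eq_zero]
    exact (finsum_comp_equiv (Equiv.addRight r)).symm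
  rw [map_finsum _ f₁, map_finsum _ f₂, ← sub_eq_zero, ← hsum,
    ← finsum_add_distrib (finite_support_of_imp f₁ fun p hp => by rw [hp, map_zero])
      (finite_support_of_imp f₂ fun p hp => by rw [hp, map_zero]),
    ← finsum_add_distrib f₃ f₄, ← finsum_sub_distrib]
  · refine finsum_congr fun p => ?_
    have hHxy (x : ℤ) : H x =
        (A[[x]]) ((B[[m + r - 1 - x]]) v) - (C[[x]]) ((D[[m + r - 1 - x]]) v) := by
      have := LinearMap.congr_fun (h x (m + r - 1 - x)) v
      simp only [LinearMap.sub_apply, LinearMap.add_apply, Module.End.mul_apply] at this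
      simp only [H]
      rcases lt_or_ge x 0 with h0 | h0
      · rw [ord_of_neg _ _ _ h0, ord_of_neg _ _ _ h0]
        rfl
      · rw [ord_of_nonneg _ _ _ h0, ord_of_nonneg _ _ _ h0, this]
        simp
    have hHxy' (x : ℤ) : H x =
        (B[[m + r - 1 - x]]) ((A[[x]]) v) + (D[[m + r - 1 - x]]) ((C[[x]]) v) := by
      rw [hHxy]
      exact LinearMap.congr_fun (h x (m + r - 1 - x)) v
    have hA' (p u) := LinearMap.congr_fun (hFA r p) u
    have hB' (p u) := LinearMap.congr_fun (hFB r p) u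
    have hC' (p u) := LinearMap.congr_fun (hFC r p) u
    have hD' (p u) := LinearMap.congr_fun (hFD r p) u
    simp only [Module.End.mul_apply, LinearMap.sub_apply, LinearMap.add_apply] at hA' hB' hC' hD'
    have e₁ : m - 1 - p + r = m + r - 1 - p := by ring
    have e₂ : m + r - 1 - (p + r) = m - 1 - p := by ring
    rcases lt_or_ge p 0 with h0 | h0
    · rw [hHxy, hHxy, e₂]
      simp only [ord_of_neg _ _ _ h0, Module.End.mul_apply, hA', hB', hC', hD', map_add, map_sub,
        e₁]
      abel
    · rw [hHxy', hHxy', e₂]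
      simp only [ord_of_nonneg _ _ _ h0, LinearMap.smul_apply, Module.End.mul_apply, hA', hB', hC',
        hD', map_add, map_sub, map_smul, e₁]
      module
  · exact Set.Finite.subset (Set.Finite.union
      (finite_support_of_imp f₁ fun p hp => by rw [hp, map_zero])
      (finite_support_of_imp f₂ fun p hp => by rw [hp, map_zero])) (Function.support_add _ _)
  · exact Set.Finite.subset (Set.Finite.union f₃ f₄) (Function.support_add _ _)

theorem mode_mul_sub {F A B : VertexOperator ℂ V}
    (hA : ∀ p q, F[[p]] * A[[q]] = A[[q]] * F[[p]])
    (hB : ∀ p q, F[[p]] * B[[q]] = B[[q]] * F[[p]]) (p q : ℤ) :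
    F[[p]] * (A - B)[[q]] = (A - B)[[q]] * F[[p]] := by
  rw [map_sub, Pi.sub_apply, mul_sub, sub_mul, hA, hB]

end Fields

/-! ### The currents and the BRST charge -/

theorem hasParity_current (j : Fin n) : HasParity (parity n) 0 (current j) :=
  (hasParity_nop_gen (.inl (.X j)) (.inl (.Y j))).add
    ((hasParity_nop_gen (.inr (.psi j)) (.inr (.chi j))).congr (by simp [genParity]))

theorem current_mul_gen (g : Boson n ⊕ Fermion n) (j : Fin n) (m q : ℤ) :
    (current j)[[m]] * (gen g)[[q]] = (gen g)[[q]] * (current j)[[m]]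
      - (contr g (.inl (.X j)) (.inl (.Y j)) + contr g (.inr (.psi j)) (.inr (.chi j)))[[q + m]] := by
  have h₁ := gen_mul_nop g (.inl (.X j)) (.inl (.Y j)) q m
  have h₂ := gen_mul_nop g (.inr (.psi j)) (.inr (.chi j)) q m
  have h₃ : (-1 : ℂ) ^ (genParity g * 2) = 1 := by rw [mul_comm, pow_mul]; simp
  simp only [genParity, Sum.elim_inl, Sum.elim_inr, mul_zero, pow_zero, one_smul, add_zero,
    one_add_one_eq_two] at h₁ h₂
  erw [h₃, one_smul] at h₂
  rw [current, X_eq, Y_eq, psi_eq, chi_eq, map_add, map_add, Pi.add_apply, Pi.add_apply, mul_add,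
    h₁, h₂]
  noncomm_ring

theorem current_mul_gen_of_contr_eq_zero {g : Boson n ⊕ Fermion n} {j : Fin n}
    (h : contr g (.inl (.X j)) (.inl (.Y j)) + contr g (.inr (.psi j)) (.inr (.chi j)) = 0)
    (m q : ℤ) : (current j)[[m]] * (gen g)[[q]] = (gen g)[[q]] * (current j)[[m]] := by
  refine (current_mul_gen g j m q).trans ?_
  rw [h, map_zero]
  exact sub_zero (G := Module.End ℂ (Fock n)) _

/-- Currents with distinct indices share no contraction. For equal indices each of X, Y, ψ, χ is
charged, but the bosonic and fermionic double poles cancel. -/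
theorem current_mul_current (i j : Fin n) (p q : ℤ) :
    (current i)[[p]] * (current j)[[q]] = (current j)[[q]] * (current i)[[p]] := by
  have hΓ := parity_mul_parity n
  by_cases hij : i = j
  · subst hij
    have hX := current_mul_gen (.inl (.X i)) i
    have hY := current_mul_gen (.inl (.Y i)) i
    have hψ := current_mul_gen (.inr (.psi i)) i
    have hχ := current_mul_gen (.inr (.chi i)) i
    simp only [contr, genPairing, bosonPairing, fermionPairing, Fermion.dual, genParity,
      Sum.elim_inl, Sum.elim_inr, if_true, reduceCtorEq, if_false, zero_smul, mul_zero, mul_one,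
      add_zero, zero_add, pow_zero, pow_one, one_smul] at hX hY hψ hχ
    refine mode_mul_current hΓ (hasParity_gen (.inl (.X i))) (hasParity_gen (.inl (.Y i)))
      (hasParity_gen (.inr (.psi i))) (hasParity_gen (.inr (.chi i))) hX (fun r p => ?_)
      (fun r p => ?_) hχ (fun x y => ?_) p q
    · rw [hY, map_smul, Pi.smul_apply]
      module
    · rw [hψ, map_smul, Pi.smul_apply]
      module
    · have h₁ := gen_mul_gen (.inl (.X i)) (.inl (.Y i)) x y
      have h₂ := gen_mul_gen (.inr (.psi i)) (.inr (.chi i)) x y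
      simp only [genPairing, bosonPairing, fermionPairing, Fermion.dual, genParity,
        Sum.elim_inl, Sum.elim_inr, if_true, mul_zero, mul_one, pow_zero, pow_one, one_smul]
        at h₁ h₂
      rw [h₁, h₂]
      module
  · have key (g : Boson n ⊕ Fermion n) (hg : g = .inl (.X j) ∨ g = .inl (.Y j) ∨
        g = .inr (.psi j) ∨ g = .inr (.chi j)) (q p : ℤ) :
        (current i)[[q]] * (gen g)[[p]] =
          (-1 : ℂ) ^ (0 * genParity g) • ((gen g)[[p]] * (current i)[[q]]) := by
      rw [zero_mul, pow_zero, one_smul]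
      refine current_mul_gen_of_contr_eq_zero ?_ q p
      rcases hg with rfl | rfl | rfl | rfl <;>
        simp [contr, genPairing, bosonPairing, fermionPairing, Fermion.dual, hij, Ne.symm hij]
    have h₁ := mode_mul_opProd_zero_of_commute hΓ (hasParity_gen (.inl (.X j)))
      (hasParity_gen (.inl (.Y j))) (key _ (by simp)) (key _ (by simp)) p q
    have h₂ := mode_mul_opProd_zero_of_commute hΓ (hasParity_gen (.inr (.psi j)))
      (hasParity_gen (.inr (.chi j))) (key _ (by simp)) (key _ (by simp)) p q
    rw [zero_mul, pow_zero, one_smul] at h₁ h₂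
    have h₃ : (current j)[[q]] =
      (opProd (parity n) 0 (gen (.inl (.X j))) (gen (.inl (.Y j))))[[q]] +
        (opProd (parity n) 0 (gen (.inr (.psi j))) (gen (.inr (.chi j))))[[q]] := by
      rw [current, map_add]
      rfl
    rw [h₃, mul_add, add_mul, h₁, h₂]

/-- The difference `Nₐ - Nₐ₊₁` of neighbouring currents. -/
noncomputable def currentDiff (a : Fin (n - 1)) : VertexOperator ℂ (Fock n) :=
  current ⟨a, by omega⟩ - current ⟨a + 1, by omega⟩

theorem hasParity_currentDiff (a : Fin (n - 1)) : HasParity (parity n) 0 (currentDiff a) :=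
  (hasParity_current _).sub (hasParity_current _)

theorem hasParity_ghostB (a : Fin (n - 1)) : HasParity (parity n) 1 (ghostB a) :=
  hasParity_fermionField _

theorem hasParity_ghostC (a : Fin (n - 1)) : HasParity (parity n) 1 (ghostC a) :=
  hasParity_fermionField _

theorem current_mul_ghostC (j : Fin n) (a : Fin (n - 1)) (m q : ℤ) :
    (current j)[[m]] * (ghostC a)[[q]] = (ghostC a)[[q]] * (current j)[[m]] := by
  refine current_mul_gen_of_contr_eq_zero (g := .inr (.c a)) ?_ m q
  simp [contr, genPairing, fermionPairing, Fermion.dual]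

theorem current_mul_ghostB (j : Fin n) (a : Fin (n - 1)) (m q : ℤ) :
    (current j)[[m]] * (ghostB a)[[q]] = (ghostB a)[[q]] * (current j)[[m]] := by
  refine current_mul_gen_of_contr_eq_zero (g := .inr (.b a)) ?_ m q
  simp [contr, genPairing, fermionPairing, Fermion.dual]

theorem current_mul_currentDiff (j : Fin n) (a : Fin (n - 1)) (p q : ℤ) :
    (current j)[[p]] * (currentDiff a)[[q]] = (currentDiff a)[[q]] * (current j)[[p]] :=
  mode_mul_sub (current_mul_current j _) (current_mul_current j _) p q

theorem ghostB_mul_currentDiff (b a : Fin (n - 1)) (p q : ℤ) :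
    (ghostB b)[[p]] * (currentDiff a)[[q]] = (currentDiff a)[[q]] * (ghostB b)[[p]] :=
  mode_mul_sub (fun p q => (current_mul_ghostB _ b q p).symm)
    (fun p q => (current_mul_ghostB _ b q p).symm) p q

theorem brstCurrent_eq (n : ℕ) :
    brstCurrent n = ∑ a, opProd (parity n) 0 (ghostC a) (currentDiff a) := rfl

theorem hasParity_brstCurrent (n : ℕ) : HasParity (parity n) 1 (brstCurrent n) := by
  have h (a : Fin (n - 1)) :=
    (hasParity_ghostC a).opProd_zero (parity_mul_parity n) (hasParity_currentDiff a)
  rw [brstCurrent_eq]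
  exact HasParity.sum Finset.univ h

theorem ncoeff_brstCurrent (n : ℕ) (m : ℤ) :
    (brstCurrent n)[[m]] = ∑ a, (opProd (parity n) 0 (ghostC a) (currentDiff a))[[m]] := by
  rw [brstCurrent_eq, map_sum, Finset.sum_apply]

theorem current_mul_brstCurrent (j : Fin n) (m q : ℤ) :
    (current j)[[m]] * (brstCurrent n)[[q]] = (brstCurrent n)[[q]] * (current j)[[m]] := by
  rw [ncoeff_brstCurrent, Finset.mul_sum, Finset.sum_mul]
  refine Finset.sum_congr rfl fun a _ => ?_
  have := mode_mul_opProd_zero_of_commute (e := 0) (F := current j) (parity_mul_parity n)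
    (hasParity_ghostC a) (hasParity_currentDiff a)
    (fun q p => by simpa using current_mul_ghostC j a q p)
    (fun q p => by
      rw [zero_mul, pow_zero, one_smul]
      exact current_mul_currentDiff j a q p) m q
  simpa using this

/-- In the BRST current b_a contracts only with c^a, which leaves the coefficient of c^a. -/
theorem brst_ghostB (a : Fin (n - 1)) : brst (ghostB a) = currentDiff a := by
  refine field_ext fun m v => ?_
  rw [brst, ncoeff_opProd_one (parity_mul_parity n) (hasParity_brstCurrent n) (hasParity_ghostB a),
    ncoeff_brstCurrent, Finset.sum_mul, Finset.mul_sum]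
  have key (a' : Fin (n - 1)) : (ghostB a)[[m]] *
      (opProd (parity n) 0 (ghostC a') (currentDiff a'))[[0]] =
      -((opProd (parity n) 0 (ghostC a') (currentDiff a'))[[0]] * (ghostB a)[[m]])
        + if a = a' then (currentDiff a)[[m]] else 0 := by
    have := mode_mul_opProd_zero (e := 1) (F := ghostB a) (parity_mul_parity n)
      (hasParity_ghostC a') (hasParity_currentDiff a') (if a = a' then 1 else 0) 0 (by simp)
      (by simp) (fun q p => ?_) (fun q p => ?_) m 0
    · rw [this]
      split_ifs with h
      · subst h
        simp only [add_zero, mul_one, pow_one, mul_zero]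
        module
      · simp only [add_zero, mul_one, pow_one, mul_zero]
        module
    · refine (fermionField_mul_fermionField (.b a) (.c a') q p).trans ?_
      simp only [fermionPairing, Fermion.dual, Fermion.c.injEq, eq_comm (a := a')]
      rfl
    · rw [mul_zero, pow_zero, one_smul, ite_self, zero_smul, add_zero]
      exact ghostB_mul_currentDiff a a' q p
  rw [Finset.sum_congr rfl fun a' _ => key a', Finset.sum_add_distrib, Finset.sum_ite_eq]
  simp

/-! ### Exactness of products of differences of currents -/

/-- The BRST operator as a linear map. -/
noncomputable def brstₗ (n : ℕ) : VertexOperator ℂ (Fock n) →ₗ[ℂ] VertexOperator ℂ (Fock n) :=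
  opProdₗ (parity n) 1 (brstCurrent n)

theorem opProd_mem_operators {A B : VertexOperator ℂ (Fock n)} (p : ℤ) (hA : A ∈ operators n)
    (hB : B ∈ operators n) : opProd (parity n) p A B ∈ operators n := by
  rw [operators, operatorSpace, Submodule.mem_sInf] at *
  exact fun S hS => hS.2.2 p A (hA S hS) B (hB S hS)

theorem gen_mem_operators (g : Boson n ⊕ Fermion n) : gen g ∈ operators n := by
  rw [operators, operatorSpace, Submodule.mem_sInf]
  refine fun S hS => hS.2.1 ?_
  rcases g with φ | φ
  · exact Or.inl ⟨φ, rfl⟩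
  · exact Or.inr ⟨φ, rfl⟩

theorem current_mem_operators (j : Fin n) : current j ∈ operators n :=
  add_mem (opProd_mem_operators 0 (gen_mem_operators (.inl (.X j))) (gen_mem_operators (.inl (.Y j))))
    (opProd_mem_operators 0 (gen_mem_operators (.inr (.psi j))) (gen_mem_operators (.inr (.chi j))))

/-- The fields `D` for which the normally ordered product `D P` is BRST exact. -/
noncomputable def exactMultipliers (P : VertexOperator ℂ (Fock n)) :
    Submodule ℂ (VertexOperator ℂ (Fock n)) :=
  ((operators n).map (brstₗ n)).comap ((opProdₗ (parity n) 0).flip P)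

theorem mem_exactMultipliers {D P : VertexOperator ℂ (Fock n)} :
    D ∈ exactMultipliers P ↔ ∃ C ∈ operators n, brst C = nop D P := Iff.rfl

/-- The primitive is b_a P: the charge annihilates P, so it acts on b_a alone. -/
theorem currentDiff_mem_exactMultipliers {P : VertexOperator ℂ (Fock n)}
    (hP : P ∈ Submodule.span ℂ (Set.range (current (n := n)))) (a : Fin (n - 1)) :
    currentDiff a ∈ exactMultipliers P := by
  have hΓ := parity_mul_parity n
  have hP' : P ∈ operators n ∧ HasParity (parity n) 0 P ∧
      ∀ p, (brstCurrent n)[[0]] * P[[p]] = P[[p]] * (brstCurrent n)[[0]] := by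
    induction hP using Submodule.span_induction with
    | mem x hx =>
      obtain ⟨j, rfl⟩ := hx
      exact ⟨current_mem_operators j, hasParity_current j,
        fun p => (current_mul_brstCurrent j p 0).symm⟩
    | zero => exact ⟨zero_mem _, HasParity.zero, fun p => by simp⟩
    | add x y _ _ hx hy =>
      exact ⟨add_mem hx.1 hy.1, hx.2.1.add hy.2.1,
        fun p => by simp [mul_add, add_mul, hx.2.2, hy.2.2]⟩
    | smul c x _ hx =>
      exact ⟨Submodule.smul_mem _ c hx.1, hx.2.1.smul c, fun p => by simp [hx.2.2]⟩
  refine mem_exactMultipliers.2 ⟨nop (ghostB a) P,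
    opProd_mem_operators 0 (gen_mem_operators (.inr (.b a))) hP'.1, ?_⟩
  rw [brst, nop, opProd_one_opProd_zero hΓ (hasParity_brstCurrent n) (hasParity_ghostB a) hP'.2.1
    hP'.2.2, ← brst, brst_ghostB, nop]

theorem current_sub_mem_exactMultipliers {P : VertexOperator ℂ (Fock n)}
    (hP : P ∈ Submodule.span ℂ (Set.range (current (n := n)))) (i j : Fin n) :
    current i - current j ∈ exactMultipliers P := by
  -- Telescoping from index 0 avoids ordering i and j.
  have key (k : ℕ) (hk : k < n) :
      current ⟨0, by omega⟩ - current ⟨k, hk⟩ ∈ exactMultipliers P := by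
    induction k with
    | zero => rw [sub_self]; exact zero_mem _
    | succ k ih =>
      have := add_mem (ih (by omega)) (currentDiff_mem_exactMultipliers hP ⟨k, by omega⟩)
      rwa [currentDiff, sub_add_sub_cancel] at this
  have := sub_mem (key j j.2) (key i i.2)
  rwa [sub_sub_sub_cancel_left] at this

theorem nop_comm_of_mem_span {P : VertexOperator ℂ (Fock n)}
    (hP : P ∈ Submodule.span ℂ (Set.range (current (n := n)))) (j : Fin n) :
    nop P (current j) = nop (current j) P := by
  have hΓ := parity_mul_parity n
  induction hP using Submodule.span_induction with
  | mem x hx =>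
    obtain ⟨i, rfl⟩ := hx
    have := opProd_comm hΓ (hasParity_current i) (hasParity_current j)
      fun p q => by simpa using current_mul_current i j p q
    simpa [nop] using this
  | zero => simp only [nop, ← opProdₗ_apply, map_zero, LinearMap.zero_apply]
  | add x y _ _ hx hy => rw [nop_add_left, nop_add_right, hx, hy]
  | smul c x _ hx => rw [nop_smul_left, nop_smul_right, hx]

end FreeFieldVOA

/-! ### The equivalence -/

open FreeFieldVOA in
theorem mainTheorem7 (n : ℕ) (i : Fin n) :
    FreeFieldVOA.BRSTEquiv (FreeFieldVOA.T i)
      ((1 / 2 : ℂ) • FreeFieldVOA.nop (FreeFieldVOA.U n + FreeFieldVOA.UF n)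
          (FreeFieldVOA.U n + FreeFieldVOA.UF n)
        - (1 / 2 : ℂ) • (FreeFieldVOA.nop (FreeFieldVOA.Mplus i) (FreeFieldVOA.Mminus i)
          - FreeFieldVOA.nop (FreeFieldVOA.Mminus i) (FreeFieldVOA.Mplus i))) := by
  let M : VertexOperator ℂ (Fock n) := (1 / n : ℂ) • ∑ j, current j
  have hn : (n : ℂ) ≠ 0 := by
    have := i.2
    exact_mod_cast (show n ≠ 0 by omega)
  have hcur (j : Fin n) : current j ∈ Submodule.span ℂ (Set.range (current (n := n))) :=
    Submodule.subset_span ⟨j, rfl⟩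
  have hM : M ∈ Submodule.span ℂ (Set.range (current (n := n))) :=
    Submodule.smul_mem _ _ (sum_mem fun j _ => hcur j)
  have hU : U n + UF n = (-1 : ℂ) • M := by
    simp only [U, UF, M, current, Finset.sum_add_distrib]
    module
  have hdiff : current i - M = (1 / n : ℂ) • ∑ j, (current i - current j) := by
    rw [Finset.sum_sub_distrib, Finset.sum_const, Finset.card_univ, Fintype.card_fin,
      ← Nat.cast_smul_eq_nsmul ℂ, smul_sub, smul_smul, one_div, inv_mul_cancel₀ hn, one_smul]
    simp only [M, one_div]
  -- The factor N_i + M turns the exact multiplier ½(N_i - M) into half a difference of squares.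
  have hex : (1 / 2 : ℂ) • (current i - M) ∈ exactMultipliers (current i + M) := by
    rw [hdiff]
    exact Submodule.smul_mem _ _ (Submodule.smul_mem _ _
      (sum_mem fun j _ => current_sub_mem_exactMultipliers (add_mem (hcur i) hM) i j))
  obtain ⟨C, hC, hbrst⟩ := mem_exactMultipliers.1 hex
  refine ⟨C, hC, ?_⟩
  rw [hbrst]
  have hquart := quartic_identity i
  have hcomm := nop_comm_of_mem_span hM i
  have hsq : nop (current i) (current i) =
      nop (nop (X i) (Y i)) (nop (X i) (Y i)) + nop (nop (X i) (Y i)) (nop (psi i) (chi i))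
        + nop (nop (psi i) (chi i)) (nop (X i) (Y i))
        + nop (nop (psi i) (chi i)) (nop (psi i) (chi i)) := by
    simp only [current, nop_add_left, nop_add_right]
    abel
  have hA : gaugeA i = (-1 : ℂ) • nop (X i) (Y i) := by rw [gaugeA]; module
  have hT : T i = nop (nop (X i) (Y i)) (nop (X i) (Y i))
      - (1 / 2 : ℂ) • nop (X i) (nop (Y i) (nop (X i) (Y i))) := by
    simp only [T, covD, partialD, hatA, hA, nop_smul_left, nop_smul_right]
    module
  -- The cross terms cancel only because M and N_i commute under the normally ordered product.
  have hrhs : nop ((1 / 2 : ℂ) • (current i - M)) (current i + M) =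
      (1 / 2 : ℂ) • (nop (current i) (current i) - nop M M) := by
    rw [show current i - M = current i + (-1 : ℂ) • M by module]
    simp only [nop_add_left, nop_add_right, nop_smul_left, hcomm]
    module
  rw [hrhs, hsq, hT, hU, nop_smul_left, nop_smul_right]
  linear_combination (norm := module) (1 / 2 : ℂ) • hquart
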